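/- Let $\mathcal X$ be a finite set and let $(P_\theta)_{\theta\in\mathbb R^l}$ be a family of transition (row-stochastic) matrices on $\mathcal X$ such that every matrix in the closure $\overline{\{P_\theta:\theta\in\mathbb R^l\}}$ is irreducible and aperiodic, and let $x^*\in\mathcal X$ (a state which is then recurrent for all these matrices). Let $C_\theta:\mathcal X\to\mathbb R$ be one-step costs. Assume that for all $x,y\in\mathcal X$ the functions $\theta\mapsto P_\theta(x,y)$ and $\theta\mapsto C_\theta(x)$ are bounded and twice differentiable with bounded first and second derivatives. Let $\alpha>0$ and fix $\theta\in\mathbb R^l$. Let $(\gamma_m)_{m\ge0}$ be positive step sizes with $\sum_m\gamma_m=\infty$ and $\sum_m\gamma_m^{2(1-\beta)}<\infty$ for some fixed $\beta\in(0,1/2)$, and put $M_m=\gamma_m^{-\beta}$. Let $(\Phi_i)_{i\ge0}$ be a Markov chain with transition matrix $P_\theta$ and any initial distribution, let $t_0=0$, and for $m\ge0$ let $t_{m+1}$ be the first time after $t_m$ at which the chain visits $x^*$. For an arbitrary $\tilde\Lambda_0\in\mathbb R$ define $$\tilde\Lambda_{m+1}=\tilde\Lambda_m+\gamma_m\left(\min\left\{\exp\left(\sum_{i=t_m}^{t_{m+1}-1}\bigl(\alpha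 C_\theta(\Phi_i)-\tilde\Lambda_m\bigr)\right),\,M_m\right\}-1\right),\qquad m\ge0.$$ Then the risk-sensitive cost $$\Lambda_\theta=\lim_{n\to\infty}\frac1n\ln \mathbb E_x\left[\exp\left(\alpha\sum_{i=0}^{n-1}C_\theta(\Phi_i)\right)\right]$$ exists and has the same value for every initial state $x\in\mathcal X$ (where $\mathbb E_x$ is the expectation for the chain with transition matrix $P_\theta$ started at $x$), and $\tilde\Lambda_m\to\Lambda_\theta$ almost surely. -/

import Mathlib

open MeasureTheory Filter Topology

/-- A real square matrix is aperiodic if for every state `x` the only common divisor of the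
lengths `n ≥ 1` of possible returns from `x` to `x` is `1`. -/
def Matrix.IsAperiodic {X : Type*} [Fintype X] [DecidableEq X] (Q : Matrix X X ℝ) : Prop :=
  ∀ x : X, ∀ d : ℕ, (∀ n : ℕ, 1 ≤ n → 0 < (Q ^ n) x x → d ∣ n) → d = 1

/-- The standing assumption on the parameterized family of transition matrices: each `P θ` is a
transition matrix, and every matrix in the closure of `{P θ}` is irreducible and aperiodic.
(The state space is finite, so every state is then recurrent for every one of these matrices:
any state may play the role of the common recurrent state.) -/
structure ErgodicFamily {X : Type*} [Fintype X] [DecidableEq X] {l : ℕ}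
    (P : EuclideanSpace ℝ (Fin l) → Matrix X X ℝ) : Prop where
  stochastic : ∀ θ, P θ ∈ Matrix.rowStochastic ℝ X
  irreducible : ∀ Q ∈ closure (Set.range P), Q.IsIrreducible
  aperiodic : ∀ Q ∈ closure (Set.range P), Q.IsAperiodic

/-- `f` is bounded, twice differentiable, with bounded first and second derivatives. -/
def BoundedTwiceDifferentiable {l : ℕ} (f : EuclideanSpace ℝ (Fin l) → ℝ) : Prop :=
  Differentiable ℝ f ∧ Differentiable ℝ (fderiv ℝ f) ∧
    ∃ K : ℝ, ∀ θ, |f θ| ≤ K ∧ ‖fderiv ℝ f θ‖ ≤ K ∧ ‖fderiv ℝ (fderiv ℝ f) θ‖ ≤ K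

/-- `Φ` is a time-homogeneous Markov chain on `(Ω, μ)` with transition matrix `Q` and arbitrary
initial law: given any history `x 0, …, x n`, the next state is `x (n + 1)` with probability
`Q (x n) (x (n + 1))`. -/
structure IsMarkovChain {X Ω : Type*} [MeasurableSpace X] [MeasurableSpace Ω]
    (Q : Matrix X X ℝ) (μ : Measure Ω) (Φ : ℕ → Ω → X) : Prop where
  measurable : ∀ n, Measurable (Φ n)
  transition : ∀ (n : ℕ) (x : ℕ → X),
    μ.real {ω | ∀ i ≤ n + 1, Φ i ω = x i} =
      μ.real {ω | ∀ i ≤ n, Φ i ω = x i} * Q (x n) (x (n + 1))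

/-- The expectation of `F (Φ 0, …, Φ n)` for the Markov chain `Φ` with transition matrix `Q`
started at `Φ 0 = x`: the sum over all paths of their probability times the value of `F`. -/
noncomputable def pathExpectation {X : Type*} [Fintype X] [DecidableEq X]
    (Q : Matrix X X ℝ) (x : X) (n : ℕ) (F : (Fin (n + 1) → X) → ℝ) : ℝ :=
  ∑ p : Fin (n + 1) → X,
    if p 0 = x then (∏ i : Fin n, Q (p i.castSucc) (p i.succ)) * F p else 0

/-- `pathExpectation` is the expectation over any realization of the chain started at `x`. -/
theorem IsMarkovChain.integral_eq_pathExpectation {X Ω : Type*} [Fintype X] [DecidableEq X]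
    [MeasurableSpace X] [MeasurableSingletonClass X] [MeasurableSpace Ω]
    {Q : Matrix X X ℝ} {μ : Measure Ω} [IsProbabilityMeasure μ] {Φ : ℕ → Ω → X}
    (h : IsMarkovChain Q μ Φ) {x : X} (hx : ∀ᵐ ω ∂μ, Φ 0 ω = x) (n : ℕ)
    (F : (Fin (n + 1) → X) → ℝ) :
    ∫ ω, F (fun i => Φ i ω) ∂μ = pathExpectation Q x n F := by
  have hpath : ∀ (y : ℕ → X) (m : ℕ), μ.real {ω | ∀ i ≤ m, Φ i ω = y i} =
      if y 0 = x then ∏ i : Fin m, Q (y i) (y (i + 1)) else 0 := by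
    intro y m
    induction m with
    | zero =>
      by_cases hy : y 0 = x
      · have : μ {ω | ∀ i ≤ 0, Φ i ω = y i} = μ Set.univ :=
          measure_congr (Filter.eventuallyEq_set.2
            (by filter_upwards [hx] with ω hω; simp [hω, hy]))
        rw [measureReal_def, this]
        simp [hy]
      · have : μ {ω | ∀ i ≤ 0, Φ i ω = y i} = μ ∅ :=
          measure_congr (Filter.eventuallyEq_set.2
            (by filter_upwards [hx] with ω hω; simp [hω, Ne.symm hy]))
        rw [measureReal_def, this]
        simp [hy]
    | succ m ih =>
      rw [h.transition, ih, Fin.prod_univ_castSucc]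
      split_ifs <;> simp
  have hmeas : Measurable (fun ω => (fun i : Fin (n + 1) => Φ i ω)) :=
    measurable_pi_lambda _ fun i => h.measurable i
  rw [← integral_map (φ := fun ω => (fun i : Fin (n + 1) => Φ i ω)) hmeas.aemeasurable
    (f := F) (Measurable.of_discrete.aestronglyMeasurable),
    integral_fintype (Integrable.of_finite), pathExpectation]
  refine Finset.sum_congr rfl fun p _ => ?_
  have hp := hpath (fun k => if hk : k < n + 1 then p ⟨k, hk⟩ else x) n
  have hset : (fun ω => (fun i : Fin (n + 1) => Φ i ω)) ⁻¹' {p} =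
      {ω | ∀ i ≤ n, Φ i ω = if hk : i < n + 1 then p ⟨i, hk⟩ else x} := by
    ext ω
    simp only [Set.mem_preimage, Set.mem_singleton_iff, Set.mem_ofPred_eq, funext_iff]
    constructor
    · intro hh i hi
      simpa [Nat.lt_succ_of_le hi] using hh ⟨i, Nat.lt_succ_of_le hi⟩
    · intro hh i
      simpa [i.2] using hh i (Nat.le_of_lt_succ i.2)
  rw [measureReal_def, Measure.map_apply hmeas (measurableSet_singleton p), ← measureReal_def,
    hset, hp]
  have h0 : (⟨0, Nat.succ_pos n⟩ : Fin (n + 1)) = 0 := rfl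
  simp only [Nat.succ_pos, dite_true, h0]
  split_ifs with hc
  · rw [smul_eq_mul]
    congr 1
    refine Finset.prod_congr rfl fun i _ => ?_
    have h1 : (i : ℕ) < n + 1 := by omega
    have h2 : (i : ℕ) + 1 < n + 1 := by omega
    simp only [h1, h2, dite_true]
    rfl
  · simp

/-- `Λ` is the risk-sensitive cost, with risk factor `α`, of the Markov chain with transition
matrix `Q` and one-step cost `C`: for every initial state `x`,
`(1 / n) * log E_x[exp (α * ∑_{i < n} C (Φ i))] → Λ`. -/
def IsRiskSensitiveCost {X : Type*} [Fintype X] [DecidableEq X]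
    (Q : Matrix X X ℝ) (C : X → ℝ) (α Λ : ℝ) : Prop :=
  ∀ x : X, Tendsto (fun n : ℕ => (1 / (n : ℝ)) *
      Real.log (pathExpectation Q x n
        (fun p => Real.exp (α * ∑ i : Fin n, C (p i.castSucc)))))
    atTop (𝓝 Λ)

/-- The times `t 0 = 0` and `t (m + 1) =` the first visit of the trajectory `φ` to `xs` after
time `t m`. -/
noncomputable def visitTime {X : Type*} (xs : X) (φ : ℕ → X) : ℕ → ℕ
  | 0 => 0
  | m + 1 => sInf {i : ℕ | visitTime xs φ m < i ∧ φ i = xs}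

/-- The truncated policy-evaluation iteration along the trajectory `φ`, with one-step cost `C`,
risk factor `α`, step sizes `γ`, truncation levels `M` and initial estimate `L₀`. -/
noncomputable def costEstimate {X : Type*} (C : X → ℝ) (α : ℝ) (xs : X) (γ M : ℕ → ℝ) (L₀ : ℝ)
    (φ : ℕ → X) : ℕ → ℝ
  | 0 => L₀
  | m + 1 =>
    costEstimate C α xs γ M L₀ φ m + γ m *
      (min (Real.exp (∑ i ∈ Finset.Ico (visitTime xs φ m) (visitTime xs φ (m + 1)),
          (α * C (φ i) - costEstimate C α xs γ M L₀ φ m))) (M m) - 1)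

/-!
The risk-sensitive cost is `Λ = log ρ`, where `ρ` is the Perron eigenvalue of the tilted matrix
`A = diag (exp (α C)) P`: since `A v = ρ v` for a positive vector `v`
(`Matrix.IsIrreducible.exists_pos_eigenvector`), the exponential moments `(A ^ n) 1` of the cost lie
between constant multiples of `ρ ^ n` (`isRiskSensitiveCost_log`).

The same eigenvector characterizes `Λ` through cycles. The matrix
`A x y * v y / (ρ * v x)` is stochastic and irreducible, so the chain it drives returns to `xs` with
probability `1`; along a cycle from `xs` to `xs` the factors `v` cancel, which says that the cost
of a cycle, centred at `Λ`, has exponential mean `1` under the original chain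
(`hasSum_returnWeight_mul_exp`). As every cycle has length at least `1`, the exponential mean centred
at `a` is at most `exp (Λ - a) < 1` if `Λ < a` and at least `exp (Λ - a) > 1` if `a < Λ`. Truncation at
`M m → ∞` preserves both bounds, the second one for large `m`
(`integral_truncatedPayoff_le`, `eventually_le_integral_truncatedPayoff`).

By regeneration, each cycle after the first is independent of the past and has a fixed law
(`IsMarkovChain.map_cycleHistory_cycleWord`). Conditionally on the past, the iteration thus moves by
`γ m` times the mean field, plus a martingale difference bounded by
`γ m * M m = γ m ^ (1 - β)`. These bounds are square-summable, so the noise series converges almost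
surely (`ae_exists_tendsto_sum_of_map_eq_prod`). The drift steps lie between `-γ m` and
`γ m ^ (1 - β)` and tend to `0`, the drift points towards `Λ`, and `∑ γ m = ∞`: on each such trajectory
the iteration converges to `Λ` by a deterministic argument (`tendsto_of_robbinsMonro`), without any
prior bound on the iterates.
-/

/-! ### Perron vectors -/

/-- In an irreducible matrix, a nonempty set of states closed under the edges is everything. -/
theorem Matrix.IsIrreducible.mem_of_closed {X : Type*} {A : Matrix X X ℝ} (hA : A.IsIrreducible)
    {S : Set X} (hS : ∀ i ∈ S, ∀ j, 0 < A i j → j ∈ S) {i : X} (hi : i ∈ S) (j : X) : j ∈ S := by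
  let : Quiver X := A.toQuiver
  obtain ⟨p, -⟩ := hA.connected i j
  induction p with
  | nil => exact hi
  | cons q e ih => exact hS _ ih _ e.down

/-- Irreducibility only depends on which entries are positive. -/
theorem Matrix.IsIrreducible.of_pos_iff {X : Type*} {A B : Matrix X X ℝ} (hA : A.IsIrreducible)
    (hB : ∀ i j, 0 ≤ B i j) (h : ∀ i j, 0 < A i j ↔ 0 < B i j) : B.IsIrreducible := by
  refine ⟨hB, ?_⟩
  have : A.toQuiver = B.toQuiver := by
    simp only [Matrix.toQuiver, h]
  rw [← this]
  exact hA.connected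

/-- **Perron's theorem**: an irreducible nonnegative matrix has a positive eigenvector. The
eigenvalue is the largest `t` with `t v ≤ A v` for some `v` in the simplex (Collatz–Wielandt). -/
theorem Matrix.IsIrreducible.exists_pos_eigenvector {X : Type*} [Fintype X] [DecidableEq X]
    [Nonempty X] {A : Matrix X X ℝ} (hA : A.IsIrreducible) :
    ∃ (ρ : ℝ) (v : X → ℝ), (∀ i, 0 < v i) ∧ A.mulVec v = ρ • v := by
  classical
  have hnn := hA.nonneg
  set R : ℝ := ∑ i, ∑ j, A i j
  set K : Set (ℝ × (X → ℝ)) :=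
    {p | p ∈ Set.Icc 0 R ×ˢ stdSimplex ℝ X ∧ ∀ i, p.1 * p.2 i ≤ A.mulVec p.2 i}
  have hmem : ∀ (t : ℝ) (w : X → ℝ), 0 ≤ t → w ∈ stdSimplex ℝ X →
      (∀ i, t * w i ≤ A.mulVec w i) → (t, w) ∈ K := by
    intro t w ht hw h
    refine ⟨⟨⟨ht, ?_⟩, hw⟩, h⟩
    have hw1 : ∀ j, w j ≤ 1 := fun j => by
      rw [← hw.2]; exact Finset.single_le_sum (fun i _ => hw.1 i) (Finset.mem_univ j)
    calc t = ∑ i, t * w i := by rw [← Finset.mul_sum, hw.2, mul_one]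
      _ ≤ ∑ i, A.mulVec w i := Finset.sum_le_sum fun i _ => h i
      _ ≤ R := Finset.sum_le_sum fun i _ => Finset.sum_le_sum fun j _ =>
          mul_le_of_le_one_right (hnn i j) (hw1 j)
  have hKc : IsCompact K := by
    refine (isCompact_Icc.prod (isCompact_stdSimplex ℝ X)).of_isClosed_subset ?_ fun p hp => hp.1
    refine IsClosed.inter (isClosed_Icc.prod (isClosed_stdSimplex ℝ X)) ?_
    have hset : {p : ℝ × (X → ℝ) | ∀ i, p.1 * p.2 i ≤ A.mulVec p.2 i} =
        ⋂ i, {p : ℝ × (X → ℝ) | p.1 * p.2 i ≤ A.mulVec p.2 i} := by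
      ext p
      simp only [Set.mem_iInter, Set.mem_ofPred_eq]
    have hcl : IsClosed {p : ℝ × (X → ℝ) | ∀ i, p.1 * p.2 i ≤ A.mulVec p.2 i} := by
      rw [hset]
      refine isClosed_iInter fun i => isClosed_le (by fun_prop) ?_
      simp only [Matrix.mulVec, dotProduct]
      fun_prop
    exact hcl
  have hKn : K.Nonempty := by
    obtain ⟨i⟩ := ‹Nonempty X›
    refine ⟨(0, Pi.single i 1), hmem _ _ le_rfl (single_mem_stdSimplex ℝ i) fun j => ?_⟩
    rw [zero_mul]
    refine Finset.sum_nonneg fun k _ => mul_nonneg (hnn _ _) ?_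
    exact (single_mem_stdSimplex ℝ i).1 k
  obtain ⟨⟨ρ, v⟩, hvK, hmax⟩ := hKc.exists_isMaxOn hKn continuous_fst.continuousOn
  obtain ⟨⟨⟨hρ0, -⟩, hv⟩, hle⟩ := hvK
  simp only at hρ0 hv hle
  have hpow : ∀ i j, ∃ k, 0 < (A ^ k) i j := by
    intro i j
    refine hA.mem_of_closed (S := {j | ∃ k, 0 < (A ^ k) i j}) (i := i) ?_ ⟨0, by simp⟩ j
    rintro a ⟨k, hk⟩ b hab
    refine ⟨k + 1, ?_⟩
    rw [pow_succ, Matrix.mul_apply]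
    exact Finset.sum_pos' (fun c _ => mul_nonneg (Matrix.pow_apply_nonneg hnn k i c) (hnn c b))
      ⟨a, Finset.mem_univ _, mul_pos hk hab⟩
  choose k hk using hpow
  obtain ⟨N, hN⟩ : ∃ N, ∀ i j, k i j < N := by
    refine ⟨(Finset.univ.sup fun p : X × X => k p.1 p.2) + 1, fun i j => Nat.lt_succ_of_le ?_⟩
    exact Finset.le_sup (f := fun p : X × X => k p.1 p.2) (Finset.mem_univ (i, j))
  -- A polynomial in `A` with positive entries.
  set B : Matrix X X ℝ := ∑ n ∈ Finset.range N, A ^ n with hB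
  have hBpos : ∀ i j, 0 < B i j := by
    intro i j
    rw [hB, Matrix.sum_apply]
    exact Finset.sum_pos' (fun n _ => Matrix.pow_apply_nonneg hnn n i j)
      ⟨k i j, Finset.mem_range.2 (hN i j), hk i j⟩
  have hBmul : ∀ u : X → ℝ, (∀ i, 0 ≤ u i) → (∃ i, 0 < u i) → ∀ i, 0 < B.mulVec u i := by
    rintro u hu ⟨j, hj⟩ i
    exact Finset.sum_pos' (fun c _ => mul_nonneg (hBpos i c).le (hu c))
      ⟨j, Finset.mem_univ _, mul_pos (hBpos i j) hj⟩
  have hvpos : ∃ i, 0 < v i := by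
    by_contra! h
    have : ∑ i, v i ≤ 0 := Finset.sum_nonpos fun i _ => h i
    rw [hv.2] at this
    linarith
  have heig : A.mulVec v = ρ • v := by
    by_contra hne
    have hstrict : ∃ i, 0 < (A.mulVec v - ρ • v) i := by
      by_contra! h
      refine hne (funext fun i => le_antisymm ?_ (hle i))
      simpa using h i
    -- `A w > ρ w` holds in every entry for `w = B v`, so `ρ` could be enlarged.
    set w := B.mulVec v with hw
    have hwpos := hBmul v hv.1 hvpos
    have hz := hBmul (A.mulVec v - ρ • v) (fun i => by simpa using hle i) hstrict
    have hcomm : B.mulVec (A.mulVec v - ρ • v) = A.mulVec w - ρ • w := by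
      have : B * A = A * B := by
        rw [hB, Finset.sum_mul, Finset.mul_sum]
        exact Finset.sum_congr rfl fun n _ => (pow_succ A n).symm.trans (pow_succ' A n)
      rw [Matrix.mulVec_sub, Matrix.mulVec_smul, Matrix.mulVec_mulVec, this, hw,
        Matrix.mulVec_mulVec]
    rw [hcomm] at hz
    obtain ⟨a, -, ha⟩ := Finset.exists_min_image Finset.univ
      (fun i => (A.mulVec w - ρ • w) i / w i) Finset.univ_nonempty
    set δ := (A.mulVec w - ρ • w) a / w a
    have hδpos : 0 < δ := div_pos (hz a) (hwpos a)
    have hs : 0 < ∑ i, w i := Finset.sum_pos (fun i _ => hwpos i) Finset.univ_nonempty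
    have := hmax (hmem (ρ + δ) ((∑ i, w i)⁻¹ • w) (by positivity)
      ⟨fun i => mul_nonneg (inv_nonneg.2 hs.le) (hwpos i).le, by
        simp only [Pi.smul_apply, smul_eq_mul, ← Finset.mul_sum]
        exact inv_mul_cancel₀ hs.ne'⟩ fun i => by
        have h1 := (le_div_iff₀ (hwpos i)).1 (ha i (Finset.mem_univ i))
        simp only [Pi.sub_apply, Pi.smul_apply, smul_eq_mul] at h1
        rw [Matrix.mulVec_smul, Pi.smul_apply, Pi.smul_apply, smul_eq_mul, smul_eq_mul,
          mul_left_comm]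
        refine mul_le_mul_of_nonneg_left ?_ (inv_nonneg.2 hs.le)
        linarith)
    simp only [Set.mem_ofPred_eq] at this
    linarith
  refine ⟨ρ, v, fun i => (hv.1 i).lt_of_ne fun h0 => ?_, heig⟩
  obtain ⟨j, hj⟩ := hvpos
  refine hj.ne' (hA.mem_of_closed (S := {i | v i = 0}) ?_ h0.symm j)
  intro a ha b hab
  have h := congrFun heig a
  rw [Pi.smul_apply, show v a = 0 from ha, smul_zero, Matrix.mulVec, dotProduct,
    Finset.sum_eq_zero_iff_of_nonneg fun c _ => mul_nonneg (hnn a c) (hv.1 c)] at h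
  exact (mul_eq_zero.1 (h b (Finset.mem_univ b))).resolve_left hab.ne'

/-- The matrix `diag (exp (α C)) Q` whose powers compute the exponential moments of the cost. -/
noncomputable def tiltedMatrix {X : Type*} (Q : Matrix X X ℝ) (C : X → ℝ) (α : ℝ) :
    Matrix X X ℝ :=
  fun x y => Real.exp (α * C x) * Q x y

/-- Expectation of a multiplicative functional of the path, by conditioning on the first step. -/
theorem pathExpectation_exp_eq {X : Type*} [Fintype X] [DecidableEq X] (Q : Matrix X X ℝ)
    (C : X → ℝ) (α : ℝ) (n : ℕ) (x : X) :
    pathExpectation Q x n (fun p => Real.exp (α * ∑ i : Fin n, C (p i.castSucc))) =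
      ((tiltedMatrix Q C α) ^ n).mulVec 1 x := by
  induction n generalizing x with
  | zero =>
    simp only [pathExpectation, Finset.univ_eq_empty, Finset.prod_empty, Finset.sum_empty,
      mul_zero, Real.exp_zero, mul_one, pow_zero, Matrix.one_mulVec, Pi.one_apply]
    rw [← (Equiv.funUnique (Fin 1) X).symm.sum_comp]
    simp [Equiv.funUnique]
  | succ n ih =>
    rw [pow_succ', ← Matrix.mulVec_mulVec, Matrix.mulVec, dotProduct]
    simp only [← ih, pathExpectation]
    rw [← (Fin.consEquiv fun _ => X).sum_comp, Fintype.sum_prod_type]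
    simp only [Fin.consEquiv_apply, Fin.cons_zero]
    rw [Finset.sum_eq_single x (fun b _ hb => by simp [hb]) (by simp)]
    simp only [if_true]
    simp_rw [Finset.mul_sum]
    rw [Finset.sum_comm]
    refine Finset.sum_congr rfl fun p _ => ?_
    rw [Finset.sum_eq_single (p 0) (fun b _ hb => by simp [Ne.symm hb]) (by simp)]
    simp only [if_true]
    rw [Fin.prod_univ_succ, Fin.sum_univ_succ, Real.exp_add]
    simp only [Fin.castSucc_zero, Fin.cons_zero, Fin.cons_succ, ← Fin.succ_castSucc, tiltedMatrix]
    ring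

/-- The risk-sensitive cost is the logarithm of the Perron eigenvalue of the tilted matrix. -/
theorem isRiskSensitiveCost_log {X : Type*} [Fintype X] [DecidableEq X] {Q : Matrix X X ℝ}
    (hQ : ∀ x y, 0 ≤ Q x y) {C : X → ℝ} {α ρ : ℝ} (hρ : 0 < ρ) {v : X → ℝ} (hv : ∀ i, 0 < v i)
    (heig : (tiltedMatrix Q C α).mulVec v = ρ • v) :
    IsRiskSensitiveCost Q C α (Real.log ρ) := by
  intro x
  have : Nonempty X := ⟨x⟩
  set A := tiltedMatrix Q C α
  have hnn : ∀ i j, 0 ≤ A i j := fun i j => mul_nonneg (Real.exp_pos _).le (hQ i j)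
  obtain ⟨a, -, ha⟩ := Finset.exists_min_image Finset.univ v Finset.univ_nonempty
  obtain ⟨b, -, hb⟩ := Finset.exists_max_image Finset.univ v Finset.univ_nonempty
  have hpow : ∀ n : ℕ, (A ^ n).mulVec v x = ρ ^ n * v x := by
    intro n
    have : (A ^ n).mulVec v = ρ ^ n • v := by
      induction n with
      | zero => simp
      | succ n ih => rw [pow_succ, ← Matrix.mulVec_mulVec, heig, Matrix.mulVec_smul, ih, smul_smul,
          pow_succ']
    rw [this, Pi.smul_apply, smul_eq_mul]
  have hlow : ∀ n : ℕ, ρ ^ n * (v x / v b) ≤ (A ^ n).mulVec 1 x := by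
    intro n
    rw [← mul_div_assoc, ← hpow, div_le_iff₀ (hv b), Matrix.mulVec, Matrix.mulVec, dotProduct,
      dotProduct, Finset.sum_mul]
    refine Finset.sum_le_sum fun j _ => ?_
    rw [Pi.one_apply, mul_one]
    exact mul_le_mul_of_nonneg_left (hb j (Finset.mem_univ j)) (Matrix.pow_apply_nonneg hnn n x j)
  have hup : ∀ n : ℕ, (A ^ n).mulVec 1 x ≤ ρ ^ n * (v x / v a) := by
    intro n
    rw [← mul_div_assoc, ← hpow, le_div_iff₀ (hv a), Matrix.mulVec, Matrix.mulVec, dotProduct,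
      dotProduct, Finset.sum_mul]
    refine Finset.sum_le_sum fun j _ => ?_
    rw [Pi.one_apply, mul_one]
    exact mul_le_mul_of_nonneg_left (ha j (Finset.mem_univ j)) (Matrix.pow_apply_nonneg hnn n x j)
  have hlim : ∀ c : ℝ, 0 < c →
      Tendsto (fun n : ℕ => (1 / (n : ℝ)) * Real.log (ρ ^ n * c)) atTop (𝓝 (Real.log ρ)) := by
    intro c hc
    have h1 : Tendsto (fun n : ℕ => Real.log ρ + (1 / (n : ℝ)) * Real.log c) atTop
        (𝓝 (Real.log ρ + 0 * Real.log c)) :=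
      tendsto_const_nhds.add (tendsto_one_div_atTop_nhds_zero_nat.mul_const _)
    rw [zero_mul, add_zero] at h1
    refine h1.congr' ?_
    filter_upwards [eventually_ge_atTop 1] with n hn
    have : (n : ℝ) ≠ 0 := by positivity
    rw [Real.log_mul (by positivity) hc.ne', Real.log_pow]
    field_simp
  simp only [pathExpectation_exp_eq]
  refine tendsto_of_tendsto_of_tendsto_of_le_of_le (hlim _ (div_pos (hv x) (hv b)))
    (hlim _ (div_pos (hv x) (hv a))) (fun n => ?_) (fun n => ?_)
  · exact mul_le_mul_of_nonneg_left (Real.log_le_log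
      (mul_pos (pow_pos hρ n) (div_pos (hv x) (hv b))) (hlow n)) (by positivity)
  · exact mul_le_mul_of_nonneg_left (Real.log_le_log
      ((mul_pos (pow_pos hρ n) (div_pos (hv x) (hv b))).trans_le (hlow n)) (hup n)) (by positivity)

/-! ### Weights of return words -/

/-- The probability that the chain started at `x` passes through the states of the word `l`, none
of which is `xs`, and then moves to `xs`; words that contain `xs` get weight `0`. -/
def returnWeight {X : Type*} [DecidableEq X] (Q : Matrix X X ℝ) (xs : X) : X → List X → ℝ
  | x, [] => Q x xs
  | x, y :: l => if y = xs then 0 else Q x y * returnWeight Q xs y l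

/-- The probability that the chain started at `x` avoids `xs` at the times `1, …, n`. -/
def avoidProb {X : Type*} [Fintype X] [DecidableEq X] (Q : Matrix X X ℝ) (xs : X) : ℕ → X → ℝ
  | 0, _ => 1
  | n + 1, x => ∑ y, if y = xs then 0 else Q x y * avoidProb Q xs n y

/-- The words of length less than `n`. -/
def wordsBelow (X : Type*) [Fintype X] [DecidableEq X] : ℕ → Finset (List X)
  | 0 => ∅
  | n + 1 => insert [] ((Finset.univ ×ˢ wordsBelow X n).image fun p : X × List X => p.1 :: p.2)

section

variable {X : Type*} [Fintype X] [DecidableEq X] {Q : Matrix X X ℝ} {xs : X}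

theorem mem_wordsBelow {n : ℕ} {l : List X} : l ∈ wordsBelow X n ↔ l.length < n := by
  induction n generalizing l with
  | zero => simp [wordsBelow]
  | succ n ih => cases l <;> simp [wordsBelow, ih]

theorem wordsBelow_mono : Monotone (wordsBelow X) := fun _ _ h _ hl =>
  mem_wordsBelow.2 ((mem_wordsBelow.1 hl).trans_le h)

theorem returnWeight_nonneg {X : Type*} [DecidableEq X] {Q : Matrix X X ℝ} {xs : X}
    (hQ : ∀ x y, 0 ≤ Q x y) (x : X) (l : List X) :
    0 ≤ returnWeight Q xs x l := by
  induction l generalizing x with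
  | nil => exact hQ _ _
  | cons y l ih =>
    rw [returnWeight]
    split_ifs
    · exact le_rfl
    · exact mul_nonneg (hQ _ _) (ih y)

theorem avoidProb_nonneg (hQ : ∀ x y, 0 ≤ Q x y) (n : ℕ) (x : X) : 0 ≤ avoidProb Q xs n x := by
  induction n generalizing x with
  | zero => exact zero_le_one
  | succ n ih =>
    refine Finset.sum_nonneg fun y _ => ?_
    split_ifs
    · exact le_rfl
    · exact mul_nonneg (hQ _ _) (ih y)

theorem avoidProb_antitone (hQ : Q ∈ Matrix.rowStochastic ℝ X) (x : X) :
    Antitone fun n => avoidProb Q xs n x := by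
  obtain ⟨hnn, hsum⟩ := Matrix.mem_rowStochastic_iff_sum.1 hQ
  refine antitone_nat_of_succ_le fun n => ?_
  induction n generalizing x with
  | zero =>
    rw [avoidProb, avoidProb, ← hsum x]
    refine Finset.sum_le_sum fun y _ => ?_
    split_ifs
    · exact hnn x y
    · rw [avoidProb, mul_one]
  | succ n ih =>
    rw [avoidProb, avoidProb]
    refine Finset.sum_le_sum fun y _ => ?_
    split_ifs
    · exact le_rfl
    · exact mul_le_mul_of_nonneg_left (ih y) (hnn x y)

/-- An irreducible chain visits `xs`: the limit of the avoidance probabilities is harmonic off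
`xs`, so the set where it is maximal would be closed and avoid `xs` if the maximum were positive. -/
theorem tendsto_avoidProb (hQ : Q ∈ Matrix.rowStochastic ℝ X) (hirr : Q.IsIrreducible) (x : X) :
    Tendsto (fun n => avoidProb Q xs n x) atTop (𝓝 0) := by
  obtain ⟨hnn, hsum⟩ := Matrix.mem_rowStochastic_iff_sum.1 hQ
  have : Nonempty X := ⟨x⟩
  have hlim : ∀ y, ∃ s, Tendsto (fun n => avoidProb Q xs n y) atTop (𝓝 s) := fun y =>
    ⟨_, tendsto_atTop_ciInf (avoidProb_antitone hQ y)
      ⟨0, Set.forall_mem_range.2 fun n => avoidProb_nonneg hnn n y⟩⟩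
  choose s hs using hlim
  have hs0 : ∀ y, 0 ≤ s y := fun y =>
    ge_of_tendsto' (hs y) fun n => avoidProb_nonneg hnn n y
  have hharm : ∀ y, s y = ∑ z, if z = xs then 0 else Q y z * s z := by
    intro y
    refine tendsto_nhds_unique ((tendsto_add_atTop_iff_nat 1).2 (hs y)) ?_
    simp only [avoidProb]
    refine tendsto_finsetSum _ fun z _ => ?_
    split_ifs
    · exact tendsto_const_nhds
    · exact (hs z).const_mul _
  obtain ⟨a, -, ha⟩ := Finset.exists_max_image Finset.univ s Finset.univ_nonempty
  have hsa : s a = 0 := by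
    by_contra hne
    have hpos : 0 < s a := (hs0 a).lt_of_ne (Ne.symm hne)
    have key : ∀ y, s y = s a → ∀ z, 0 < Q y z → z ≠ xs ∧ s z = s a := by
      intro y hy z hz
      have hle : ∀ w ∈ Finset.univ, (if w = xs then 0 else Q y w * s w) ≤ Q y w * s a := by
        intro w _
        split_ifs
        · exact mul_nonneg (hnn y w) hpos.le
        · exact mul_le_mul_of_nonneg_left (ha w (Finset.mem_univ w)) (hnn y w)
      have heq : (∑ w, if w = xs then 0 else Q y w * s w) = ∑ w, Q y w * s a := by
        rw [← hharm, ← Finset.sum_mul, hsum, one_mul, hy]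
      have h := (Finset.sum_eq_sum_iff_of_le hle).1 heq z (Finset.mem_univ z)
      split_ifs at h with hzx
      · exact absurd h.symm (mul_pos hz hpos).ne'
      · exact ⟨hzx, mul_left_cancel₀ hz.ne' h⟩
    have hall : ∀ z, s z = s a := fun z =>
      hirr.mem_of_closed (S := {y | s y = s a}) (i := a) (fun y hy w hw => (key y hy w hw).2) rfl z
    refine (hirr.mem_of_closed (S := {y | y ≠ xs}) (i := a) (fun y _ w hw =>
      (key y (hall y) w hw).1) ?_ xs) rfl
    rintro rfl
    obtain ⟨w, hw⟩ : ∃ w, 0 < Q a w := by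
      by_contra! h
      have := Finset.sum_nonpos fun w (_ : w ∈ Finset.univ) => h w
      rw [hsum] at this
      linarith
    exact (hirr.mem_of_closed (S := {y | y ≠ a}) (i := w) (fun y _ w hw =>
      (key y (hall y) w hw).1) (key a rfl w hw).1 a) rfl
  have : s x = 0 := le_antisymm (hsa ▸ ha x (Finset.mem_univ x)) (hs0 x)
  exact this ▸ hs x

/-- First-step analysis: the chain misses `xs` during the times `1, …, n` exactly when it does not
return along a word of length less than `n`. -/
theorem sum_wordsBelow_returnWeight (hQ : Q ∈ Matrix.rowStochastic ℝ X) (n : ℕ) (x : X) :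
    ∑ l ∈ wordsBelow X n, returnWeight Q xs x l = 1 - avoidProb Q xs n x := by
  obtain ⟨hnn, hsum⟩ := Matrix.mem_rowStochastic_iff_sum.1 hQ
  induction n generalizing x with
  | zero => simp [wordsBelow, avoidProb]
  | succ n ih =>
    rw [wordsBelow, Finset.sum_insert (by simp), Finset.sum_image, Finset.sum_product]
    · simp only [returnWeight, avoidProb]
      have : ∀ y, (∑ l ∈ wordsBelow X n, if y = xs then 0 else Q x y * returnWeight Q xs y l) =
          (if y = xs then 0 else Q x y) - if y = xs then 0 else Q x y * avoidProb Q xs n y := by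
        intro y
        split_ifs
        · simp
        · rw [← Finset.mul_sum, ih]
          ring
      simp only [this, Finset.sum_sub_distrib]
      have hoff : (∑ y, if y = xs then 0 else Q x y) = 1 - Q x xs := by
        rw [eq_sub_iff_add_eq, ← hsum x, ← Finset.sum_ite_eq_of_mem' Finset.univ xs (Q x)
          (Finset.mem_univ xs), ← Finset.sum_add_distrib]
        exact Finset.sum_congr rfl fun y _ => by split_ifs <;> simp
      rw [hoff]
      ring
    · rintro ⟨a, l⟩ - ⟨b, k⟩ - h
      simpa using h

/-- An irreducible chain returns to `xs` along some word, so the return words carry mass `1`. -/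
theorem hasSum_returnWeight (hQ : Q ∈ Matrix.rowStochastic ℝ X) (hirr : Q.IsIrreducible) (x : X) :
    HasSum (returnWeight Q xs x) 1 := by
  have hnn := (Matrix.mem_rowStochastic_iff_sum.1 hQ).1
  have hex : ∀ u : Finset (List X), ∃ n, u ⊆ wordsBelow X n := fun u =>
    ⟨u.sup List.length + 1, fun l hl =>
      mem_wordsBelow.2 (Nat.lt_succ_of_le (Finset.le_sup (f := List.length) hl))⟩
  have hsummable : Summable (returnWeight Q xs x) := by
    refine summable_of_sum_le (c := 1) (fun l => returnWeight_nonneg hnn x l) fun u => ?_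
    obtain ⟨n, hn⟩ := hex u
    refine (Finset.sum_le_sum_of_subset_of_nonneg hn fun l _ _ =>
      returnWeight_nonneg hnn x l).trans ?_
    rw [sum_wordsBelow_returnWeight hQ]
    linarith [avoidProb_nonneg hnn (xs := xs) n x]
  have h1 := hsummable.hasSum.comp
    (tendsto_atTop_finset_of_monotone (wordsBelow_mono (X := X)) fun l =>
      ⟨l.length + 1, mem_wordsBelow.2 (Nat.lt_succ_self _)⟩)
  have h2 : Tendsto (fun n => ∑ l ∈ wordsBelow X n, returnWeight Q xs x l) atTop (𝓝 1) := by
    simp only [sum_wordsBelow_returnWeight hQ]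
    simpa using (tendsto_avoidProb hQ hirr x).const_sub 1
  exact tendsto_nhds_unique h1 h2 ▸ hsummable.hasSum

/-- Doob's `h`-transform: normalizing the tilted matrix by its Perron vector gives a stochastic
matrix, whose return words carry mass `1`. On a cycle from `xs` to `xs` the Perron vector cancels,
so the exponential of the centred cost of a cycle has expectation `1` under `Q`. -/
theorem hasSum_returnWeight_mul_exp (hQ : ∀ x y, 0 ≤ Q x y) (hirr : Q.IsIrreducible) {C : X → ℝ}
    {α Λ : ℝ} {v : X → ℝ} (hv : ∀ i, 0 < v i)
    (heig : (tiltedMatrix Q C α).mulVec v = Real.exp Λ • v) :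
    HasSum (fun l => returnWeight Q xs xs l *
      Real.exp (((xs :: l).map fun y => α * C y - Λ).sum)) 1 := by
  set T : Matrix X X ℝ := fun x y => Real.exp (α * C x - Λ) * Q x y * v y / v x with hT
  have hTnn : ∀ x y, 0 ≤ T x y := fun x y =>
    div_nonneg (mul_nonneg (mul_nonneg (Real.exp_pos _).le (hQ x y)) (hv y).le) (hv x).le
  have hTs : T ∈ Matrix.rowStochastic ℝ X := by
    refine Matrix.mem_rowStochastic_iff_sum.2 ⟨hTnn, fun x => ?_⟩
    have h := congrFun heig x
    simp only [Matrix.mulVec, dotProduct, tiltedMatrix, Pi.smul_apply, smul_eq_mul] at h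
    simp only [hT, Real.exp_sub]
    rw [← Finset.sum_div, div_eq_one_iff_eq (hv x).ne']
    have : ∀ y, Real.exp (α * C x) / Real.exp Λ * Q x y * v y =
        (Real.exp (α * C x) * Q x y * v y) / Real.exp Λ := fun y => by ring
    simp only [this]
    rw [← Finset.sum_div, h, mul_div_cancel_left₀ _ (Real.exp_pos Λ).ne']
  have hTirr : T.IsIrreducible := by
    refine hirr.of_pos_iff hTnn fun x y => ?_
    simp only [hT]
    rw [div_pos_iff_of_pos_right (hv x), mul_pos_iff_of_pos_right (hv y),
      mul_pos_iff_of_pos_left (Real.exp_pos _)]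
  have hkey : ∀ x l, returnWeight T xs x l = returnWeight Q xs x l *
      Real.exp (((x :: l).map fun y => α * C y - Λ).sum) * (v xs / v x) := by
    intro x l
    induction l generalizing x with
    | nil =>
      simp only [returnWeight, hT, List.map_cons, List.map_nil, List.sum_cons, List.sum_nil,
        add_zero]
      ring
    | cons y l ih =>
      simp only [returnWeight]
      split_ifs
      · ring
      · have hcons : ((x :: y :: l).map fun z => α * C z - Λ).sum =
            (α * C x - Λ) + ((y :: l).map fun z => α * C z - Λ).sum := by
          rw [List.map_cons, List.sum_cons]
        rw [ih, hcons, Real.exp_add]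
        simp only [hT]
        have := (hv y).ne'
        have := (hv x).ne'
        field_simp
  have h := hasSum_returnWeight (xs := xs) hTs hTirr xs
  refine h.congr_fun ?_
  intro l
  rw [hkey, div_self (hv xs).ne', mul_one]

end

/-! ### Cycles of a trajectory -/

/-- The `m`-th cycle of the trajectory `φ`: its states at the times from the `m`-th visit time
up to, but not including, the next one. -/
noncomputable def cycleWord {X : Type*} (xs : X) (φ : ℕ → X) (m : ℕ) : List X :=
  (List.range' (visitTime xs φ m) (visitTime xs φ (m + 1) - visitTime xs φ m)).map φ

/-- The first `m` cycles of the trajectory `φ`, the latest one at the head. -/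
noncomputable def cycleHistory {X : Type*} (xs : X) (φ : ℕ → X) : ℕ → List (List X)
  | 0 => []
  | m + 1 => cycleWord xs φ m :: cycleHistory xs φ m

/-- From time `a` on, the trajectory `φ` passes through the states of the word `l`, none of which
is `xs`, and then visits `xs`. -/
def Follows {X : Type*} (xs : X) (φ : ℕ → X) : ℕ → List X → Prop
  | a, [] => φ a = xs
  | a, y :: l => φ a = y ∧ y ≠ xs ∧ Follows xs φ (a + 1) l

section

variable {X : Type*} {xs : X} {φ ψ : ℕ → X}

@[simp]
theorem length_cycleHistory (m : ℕ) : (cycleHistory xs φ m).length = m := by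
  induction m with
  | zero => rfl
  | succ m ih => rw [cycleHistory, List.length_cons, ih]

theorem length_cycleWord (m : ℕ) :
    (cycleWord xs φ m).length = visitTime xs φ (m + 1) - visitTime xs φ m := by
  simp [cycleWord]

theorem visitTime_succ_eq {m s : ℕ} (hs : visitTime xs φ m < s) (hφ : φ s = xs)
    (h : ∀ i, visitTime xs φ m < i → i < s → φ i ≠ xs) : visitTime xs φ (m + 1) = s := by
  rw [visitTime]
  refine le_antisymm (Nat.sInf_le ⟨hs, hφ⟩) (le_csInf ⟨s, hs, hφ⟩ ?_)
  rintro i ⟨hi, hiφ⟩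
  by_contra! hlt
  exact h i hi hlt hiφ

/-- Visit times are genuine only if `φ` keeps visiting `xs`: otherwise the infimum defining the next
one is eventually taken over the empty set and equals `0`. -/
theorem visitTime_succ_mem (hφ : ∀ n, ∃ i, n < i ∧ φ i = xs) (m : ℕ) :
    visitTime xs φ m < visitTime xs φ (m + 1) ∧ φ (visitTime xs φ (m + 1)) = xs :=
  Nat.sInf_mem (s := {i | visitTime xs φ m < i ∧ φ i = xs}) (hφ _)

theorem ne_of_lt_visitTime_succ {m i : ℕ} (h1 : visitTime xs φ m < i)
    (h2 : i < visitTime xs φ (m + 1)) : φ i ≠ xs := fun h =>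
  Nat.notMem_of_lt_sInf (s := {i | visitTime xs φ m < i ∧ φ i = xs}) h2 ⟨h1, h⟩

theorem cycleHistory_congr (hφ : ∀ n, ∃ i, n < i ∧ φ i = xs) (m : ℕ)
    (h : ∀ i ≤ visitTime xs φ m, ψ i = φ i) :
    visitTime xs ψ m = visitTime xs φ m ∧ cycleHistory xs ψ m = cycleHistory xs φ m := by
  induction m with
  | zero => exact ⟨rfl, rfl⟩
  | succ m ih =>
    obtain ⟨hlt, hv⟩ := visitTime_succ_mem hφ m
    obtain ⟨h1, h2⟩ := ih fun i hi => h i (hi.trans hlt.le)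
    have h3 : visitTime xs ψ (m + 1) = visitTime xs φ (m + 1) := by
      refine visitTime_succ_eq (h1 ▸ hlt) ((h _ le_rfl).trans hv) fun i hi hi' => ?_
      rw [h i hi'.le]
      exact ne_of_lt_visitTime_succ (h1 ▸ hi) hi'
    refine ⟨h3, ?_⟩
    rw [cycleHistory, cycleHistory, h2, cycleWord, cycleWord, h1, h3]
    congr 1
    refine List.map_congr_left fun i hi => h i ?_
    rw [List.mem_range'_1] at hi
    omega

theorem agree_of_cycleHistory_eq (hφ : ∀ n, ∃ i, n < i ∧ φ i = xs)
    (hψ : ∀ n, ∃ i, n < i ∧ ψ i = xs) (m : ℕ) (h : cycleHistory xs ψ m = cycleHistory xs φ m) :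
    visitTime xs ψ m = visitTime xs φ m ∧ ∀ i < visitTime xs φ m, ψ i = φ i := by
  induction m with
  | zero => exact ⟨rfl, fun i hi => absurd hi (Nat.not_lt_zero i)⟩
  | succ m ih =>
    rw [cycleHistory, cycleHistory, List.cons.injEq] at h
    obtain ⟨h1, h2⟩ := ih h.2
    have hlt := (visitTime_succ_mem hφ m).1
    have hlt' := (visitTime_succ_mem hψ m).1
    have h3 : visitTime xs ψ (m + 1) = visitTime xs φ (m + 1) := by
      have := congrArg List.length h.1
      rw [length_cycleWord, length_cycleWord] at this
      omega
    refine ⟨h3, fun i hi => ?_⟩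
    rcases lt_or_ge i (visitTime xs φ m) with hi' | hi'
    · exact h2 i hi'
    · have hw := h.1
      rw [cycleWord, cycleWord, h1, h3, List.map_inj_left] at hw
      refine hw i ?_
      rw [List.mem_range'_1]
      omega

/-- After the initial cycle, fixing the history amounts to fixing the trajectory up to the present
visit time. -/
theorem cycleHistory_succ_eq_iff (hφ : ∀ n, ∃ i, n < i ∧ φ i = xs)
    (hψ : ∀ n, ∃ i, n < i ∧ ψ i = xs) (m : ℕ) :
    cycleHistory xs ψ (m + 1) = cycleHistory xs φ (m + 1) ↔
      ∀ i ≤ visitTime xs φ (m + 1), ψ i = φ i := by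
  refine ⟨fun h i hi => ?_, fun h => (cycleHistory_congr hφ _ h).2⟩
  obtain ⟨h1, h2⟩ := agree_of_cycleHistory_eq hφ hψ _ h
  rcases hi.lt_or_eq with hi | rfl
  · exact h2 i hi
  · rw [(visitTime_succ_mem hφ m).2, ← h1, (visitTime_succ_mem hψ m).2]

theorem follows_iff {n : ℕ} (hn : φ n = xs) (l : List X) (a : ℕ) (ha : a ≤ n)
    (h : ∀ i, a ≤ i → i < n → φ i ≠ xs) :
    Follows xs φ a l ↔ (List.range' a (n - a)).map φ = l := by
  induction l generalizing a with
  | nil =>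
    rw [Follows, List.map_eq_nil_iff, List.range'_eq_nil_iff]
    constructor
    · intro hx
      by_contra hne
      exact h a le_rfl (by omega) hx
    · intro h0
      rw [← hn]
      congr 1
      omega
  | cons y l ih =>
    rw [Follows]
    rcases ha.lt_or_eq with hlt | rfl
    · obtain ⟨k, hk⟩ : ∃ k, n - a = k + 1 := ⟨n - a - 1, by omega⟩
      rw [ih (a + 1) hlt fun i hi hi' => h i (by omega) hi', hk, List.range'_succ, List.map_cons,
        List.cons.injEq, show n - (a + 1) = k by omega]
      constructor
      · rintro ⟨h1, -, h2⟩
        exact ⟨h1, h2⟩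
      · rintro ⟨rfl, h2⟩
        exact ⟨rfl, h a le_rfl hlt, h2⟩
    · rw [Nat.sub_self]
      constructor
      · rintro ⟨rfl, h2, -⟩
        exact absurd hn h2
      · intro h0
        simp at h0

theorem cycleWord_succ_eq_iff (hφ : ∀ n, ∃ i, n < i ∧ φ i = xs) (m : ℕ) (l : List X) :
    cycleWord xs φ (m + 1) = xs :: l ↔ Follows xs φ (visitTime xs φ (m + 1) + 1) l := by
  obtain ⟨hlt, hv⟩ := visitTime_succ_mem hφ (m + 1)
  rw [follows_iff hv l _ hlt fun i hi hi' => ne_of_lt_visitTime_succ hi hi', cycleWord]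
  obtain ⟨k, hk⟩ : ∃ k, visitTime xs φ (m + 1 + 1) - visitTime xs φ (m + 1) = k + 1 :=
    ⟨_, (Nat.succ_pred_eq_of_pos (Nat.sub_pos_of_lt hlt)).symm⟩
  rw [hk, List.range'_succ, List.map_cons, List.cons.injEq, (visitTime_succ_mem hφ m).2,
    Nat.succ_eq_add_one, Nat.sub_add_eq, hk]
  simp

theorem exists_cycleWord_succ_eq (hφ : ∀ n, ∃ i, n < i ∧ φ i = xs) (m : ℕ) :
    ∃ l, cycleWord xs φ (m + 1) = xs :: l := by
  obtain ⟨hlt, -⟩ := visitTime_succ_mem hφ (m + 1)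
  obtain ⟨k, hk⟩ : ∃ k, visitTime xs φ (m + 1 + 1) - visitTime xs φ (m + 1) = k + 1 :=
    ⟨_, (Nat.succ_pred_eq_of_pos (Nat.sub_pos_of_lt hlt)).symm⟩
  rw [cycleWord, hk, List.range'_succ, List.map_cons, (visitTime_succ_mem hφ m).2]
  exact ⟨_, rfl⟩

theorem Follows.unique {a : ℕ} {l k : List X} (hl : Follows xs φ a l) (hk : Follows xs φ a k) :
    l = k := by
  induction l generalizing a k with
  | nil =>
    cases k with
    | nil => rfl
    | cons y k => exact absurd (hk.1.symm.trans hl) hk.2.1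
  | cons y l ih =>
    cases k with
    | nil => exact absurd (hl.1.symm.trans hk) hl.2.1
    | cons z k => rw [ih hl.2.2 hk.2.2, ← hl.1, ← hk.1]

theorem Follows.exists_eq {a : ℕ} {l : List X} (h : Follows xs φ a l) : ∃ i, a ≤ i ∧ φ i = xs := by
  induction l generalizing a with
  | nil => exact ⟨a, le_rfl, h⟩
  | cons y l ih =>
    obtain ⟨i, hi, hx⟩ := ih h.2.2
    exact ⟨i, by omega, hx⟩

end

/-- The law on words of a cycle from `xs` to `xs`. -/
def cycleWeight {X : Type*} [DecidableEq X] (Q : Matrix X X ℝ) (xs : X) : List X → ℝ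
  | [] => 0
  | x :: l => if x = xs then returnWeight Q xs xs l else 0

theorem hasSum_cycleWeight_mul {X : Type*} [DecidableEq X] {Q : Matrix X X ℝ} {xs : X}
    {g : List X → ℝ} {s : ℝ} (h : HasSum (fun l => returnWeight Q xs xs l * g (xs :: l)) s) :
    HasSum (fun w => cycleWeight Q xs w * g w) s := by
  have hinj : Function.Injective fun l : List X => xs :: l := fun _ _ h => (List.cons.inj h).2
  refine (hinj.hasSum_iff ?_).1 ?_
  · rintro (_ | ⟨x, l⟩) hw
    · simp [cycleWeight]
    · rw [cycleWeight, if_neg, zero_mul]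
      rintro rfl
      exact hw ⟨l, rfl⟩
  · refine h.congr_fun ?_
    intro l
    simp [cycleWeight]

theorem cycleWeight_nonneg {X : Type*} [DecidableEq X] {Q : Matrix X X ℝ} {xs : X}
    (hQ : ∀ x y, 0 ≤ Q x y) (w : List X) : 0 ≤ cycleWeight Q xs w := by
  rcases w with _ | ⟨x, l⟩
  · exact le_rfl
  · rw [cycleWeight]
    split_ifs
    · exact returnWeight_nonneg hQ _ _
    · exact le_rfl

/-! ### The law of the cycles of a Markov chain -/

/-- Words are given the discrete σ-algebra. -/
instance List.instMeasurableSpaceTop {X : Type*} : MeasurableSpace (List X) := ⊤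

instance List.instDiscreteMeasurableSpace {X : Type*} : DiscreteMeasurableSpace (List X) :=
  ⟨fun _ => trivial⟩

/-- The law of a cycle from `xs` to `xs`, as a measure on words. -/
noncomputable def cycleLaw {X : Type*} [DecidableEq X] (Q : Matrix X X ℝ) (xs : X) : Measure (List X) :=
  Measure.sum fun w => ENNReal.ofReal (cycleWeight Q xs w) • Measure.dirac w

theorem cycleLaw_singleton {X : Type*} [Fintype X] [DecidableEq X] (Q : Matrix X X ℝ) (xs : X) (w : List X) :
    cycleLaw Q xs {w} = ENNReal.ofReal (cycleWeight Q xs w) := by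
  rw [cycleLaw, Measure.sum_apply _ (measurableSet_singleton w), tsum_eq_single w]
  · simp
  · intro k hk
    simp [hk]

/-- The Markov property for return words: given the trajectory up to time `n`, it continues along
the word `l` to `xs` with probability `returnWeight Q xs (y n) l`. -/
theorem IsMarkovChain.measureReal_follows {X Ω : Type*} [DecidableEq X] [MeasurableSpace X]
    [MeasurableSpace Ω] {Q : Matrix X X ℝ} {μ : Measure Ω} {Φ : ℕ → Ω → X} {xs : X}
    (hΦ : IsMarkovChain Q μ Φ) (n : ℕ) (y : ℕ → X)
    (l : List X) :
    μ.real {ω | (∀ i ≤ n, Φ i ω = y i) ∧ Follows xs (fun i => Φ i ω) (n + 1) l} =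
      μ.real {ω | ∀ i ≤ n, Φ i ω = y i} * returnWeight Q xs (y n) l := by
  have hstep : ∀ (n : ℕ) (y : ℕ → X) (z : X) (ω : Ω),
      (∀ i ≤ n + 1, Φ i ω = Function.update y (n + 1) z i) ↔
        (∀ i ≤ n, Φ i ω = y i) ∧ Φ (n + 1) ω = z := by
    intro n y z ω
    constructor
    · intro h
      refine ⟨fun i hi => ?_, by simpa using h (n + 1) le_rfl⟩
      have := h i (by omega)
      rwa [Function.update_of_ne (by omega)] at this
    · rintro ⟨h1, h2⟩ i hi
      rcases hi.lt_or_eq with hi | rfl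
      · rw [Function.update_of_ne (by omega)]
        exact h1 i (by omega)
      · rw [Function.update_self, h2]
  have hone : ∀ (n : ℕ) (y : ℕ → X) (z : X),
      μ.real {ω | ∀ i ≤ n + 1, Φ i ω = Function.update y (n + 1) z i} =
        μ.real {ω | ∀ i ≤ n, Φ i ω = y i} * Q (y n) z := by
    intro n y z
    rw [hΦ.transition, Function.update_self, Function.update_of_ne (by omega)]
    congr 3
    ext ω
    refine forall₂_congr fun i hi => ?_
    rw [Function.update_of_ne (by omega)]
  induction l generalizing n y with
  | nil =>
    rw [returnWeight, ← hone]
    congr 1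
    ext ω
    exact (hstep n y xs ω).symm
  | cons z l ih =>
    rw [returnWeight]
    split_ifs with hz
    · rw [mul_zero]
      have : {ω | (∀ i ≤ n, Φ i ω = y i) ∧ Follows xs (fun i => Φ i ω) (n + 1) (z :: l)} = ∅ :=
        Set.eq_empty_of_forall_notMem fun ω hω => hω.2.2.1 hz
      rw [this, measureReal_empty]
    · have h := ih (n + 1) (Function.update y (n + 1) z)
      rw [hone, Function.update_self, mul_assoc] at h
      rw [← h]
      congr 1
      ext ω
      simp only [Set.mem_ofPred_eq, hstep, Follows]
      tauto

section

variable {X : Type*} [Fintype X] [DecidableEq X] {Q : Matrix X X ℝ} {xs : X}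

theorem isProbabilityMeasure_cycleLaw (hQ : Q ∈ Matrix.rowStochastic ℝ X)
    (hirr : Q.IsIrreducible) : IsProbabilityMeasure (cycleLaw Q xs) := by
  have hnn := (Matrix.mem_rowStochastic_iff_sum.1 hQ).1
  have hs : HasSum (fun w => cycleWeight Q xs w * 1) 1 := by
    refine hasSum_cycleWeight_mul (g := fun _ => 1) ?_
    simpa using hasSum_returnWeight (xs := xs) hQ hirr xs
  simp only [mul_one] at hs
  refine ⟨?_⟩
  rw [← lintegral_one, lintegral_countable']
  simp only [cycleLaw_singleton, one_mul]
  rw [← ENNReal.ofReal_tsum_of_nonneg (cycleWeight_nonneg hnn) hs.summable, hs.tsum_eq,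
    ENNReal.ofReal_one]

/-- The exponential of the centred cost of a cycle is integrable with integral `1`. -/
theorem integral_cycleLaw_exp (hQ : ∀ x y, 0 ≤ Q x y) (hirr : Q.IsIrreducible) {C : X → ℝ}
    {α Λ : ℝ} {v : X → ℝ} (hv : ∀ i, 0 < v i)
    (heig : (tiltedMatrix Q C α).mulVec v = Real.exp Λ • v) :
    Integrable (fun w : List X => Real.exp ((w.map fun y => α * C y - Λ).sum)) (cycleLaw Q xs) ∧
      ∫ w : List X, Real.exp ((w.map fun y => α * C y - Λ).sum) ∂(cycleLaw Q xs) = 1 := by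
  have hs := hasSum_cycleWeight_mul (g := fun w => Real.exp ((w.map fun y => α * C y - Λ).sum))
    (hasSum_returnWeight_mul_exp (xs := xs) hQ hirr hv heig)
  have hl : ∫⁻ w : List X, ENNReal.ofReal (Real.exp ((w.map fun y => α * C y - Λ).sum))
      ∂(cycleLaw Q xs) = 1 := by
    rw [lintegral_countable']
    simp only [cycleLaw_singleton, ← ENNReal.ofReal_mul (Real.exp_pos _).le]
    simp only [mul_comm (Real.exp _)]
    rw [← ENNReal.ofReal_tsum_of_nonneg
      (fun w => mul_nonneg (cycleWeight_nonneg hQ w) (Real.exp_pos _).le) hs.summable,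
      hs.tsum_eq, ENNReal.ofReal_one]
  constructor
  · refine ⟨Measurable.of_discrete.aestronglyMeasurable, ?_⟩
    rw [hasFiniteIntegral_iff_ofReal (ae_of_all _ fun w => (Real.exp_pos _).le), hl]
    exact ENNReal.one_lt_top
  · rw [integral_eq_lintegral_of_nonneg_ae (ae_of_all _ fun w => (Real.exp_pos _).le)
      Measurable.of_discrete.aestronglyMeasurable, hl, ENNReal.toReal_one]

theorem ae_cycleLaw_one_le_length : ∀ᵐ w ∂(cycleLaw Q xs), 1 ≤ w.length := by
  rw [ae_iff]
  have : {w : List X | ¬1 ≤ w.length} = {[]} := by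
    ext w
    simp [List.length_eq_zero_iff, Nat.one_le_iff_ne_zero]
  rw [this, cycleLaw_singleton, cycleWeight, ENNReal.ofReal_zero]

end

section

variable {X Ω : Type*} [MeasurableSpace X] [MeasurableSingletonClass X] [MeasurableSpace Ω]
  {Φ : ℕ → Ω → X} {xs : X}

theorem measurable_visitTime (hΦ : ∀ n, Measurable (Φ n)) (m : ℕ) :
    Measurable fun ω => visitTime xs (fun i => Φ i ω) m := by
  induction m with
  | zero => exact measurable_const
  | succ m ih =>
    have hset : ∀ n i, MeasurableSet {ω | n < i ∧ Φ i ω = xs} := fun n i =>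
      (MeasurableSet.const _).inter (hΦ i (measurableSet_singleton xs))
    have hnext : ∀ n : ℕ, Measurable fun ω => sInf {i : ℕ | n < i ∧ Φ i ω = xs} := by
      intro n
      refine measurable_to_countable' fun k => ?_
      have : (fun ω => sInf {i : ℕ | n < i ∧ Φ i ω = xs}) ⁻¹' {k} =
          ({ω | n < k ∧ Φ k ω = xs} ∩ ⋂ j ∈ Set.Iio k, {ω | n < j ∧ Φ j ω = xs}ᶜ) ∪
            ({_ω | k = 0} ∩ ⋂ j, {ω | n < j ∧ Φ j ω = xs}ᶜ) := by
        ext ω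
        simp only [Set.mem_preimage, Set.mem_singleton_iff, Set.mem_union, Set.mem_inter_iff,
          Set.mem_iInter, Set.mem_compl_iff, Set.mem_ofPred_eq, Set.mem_Iio]
        constructor
        · rintro rfl
          rcases Set.eq_empty_or_nonempty {i : ℕ | n < i ∧ Φ i ω = xs} with he | hne
          · refine Or.inr ⟨by rw [he, Nat.sInf_empty], fun j hj => ?_⟩
            have : j ∈ ({i : ℕ | n < i ∧ Φ i ω = xs}) := hj
            rw [he] at this
            exact this
          · exact Or.inl ⟨Nat.sInf_mem hne, fun j hj => Nat.notMem_of_lt_sInf hj⟩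
        · rintro (⟨hk, hj⟩ | ⟨rfl, hj⟩)
          · refine le_antisymm (Nat.sInf_le hk) (le_csInf ⟨k, hk⟩ fun i hi => ?_)
            by_contra! hlt
            exact hj i hlt hi
          · have : {i : ℕ | n < i ∧ Φ i ω = xs} = ∅ := Set.eq_empty_of_forall_notMem hj
            rw [this, Nat.sInf_empty]
      rw [this]
      exact ((hset n k).inter (MeasurableSet.biInter (Set.to_countable _)
        fun j _ => (hset n j).compl)).union
        ((MeasurableSet.const _).inter (MeasurableSet.iInter fun j => (hset n j).compl))
    exact (measurable_from_prod_countable_right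
      (f := fun p : ℕ × Ω => sInf {i : ℕ | p.1 < i ∧ Φ i p.2 = xs}) hnext).comp
      (ih.prodMk measurable_id)

theorem measurableSet_cylinder (hΦ : ∀ n, Measurable (Φ n)) (n : ℕ) (y : ℕ → X) :
    MeasurableSet {ω | ∀ i ≤ n, Φ i ω = y i} := by
  simp only [Set.ofPred_forall]
  exact MeasurableSet.iInter fun i => MeasurableSet.iInter fun _ =>
    hΦ i (measurableSet_singleton _)

theorem measurableSet_follows (hΦ : ∀ n, Measurable (Φ n)) (a : ℕ) (l : List X) :
    MeasurableSet {ω | Follows xs (fun i => Φ i ω) a l} := by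
  induction l generalizing a with
  | nil => exact hΦ a (measurableSet_singleton _)
  | cons y l ih =>
    exact (hΦ a (measurableSet_singleton y)).inter ((MeasurableSet.const _).inter (ih (a + 1)))

variable [Finite X]

theorem measurable_cycleWord (hΦ : ∀ n, Measurable (Φ n)) (m : ℕ) :
    Measurable fun ω => cycleWord xs (fun i => Φ i ω) m := by
  have hword : ∀ k a : ℕ, Measurable fun ω => (List.range' a k).map fun i => Φ i ω := by
    intro k
    induction k with
    | zero => exact fun a => measurable_const
    | succ k ih =>
      intro a
      simp only [List.range'_succ, List.map_cons]
      exact (Measurable.of_discrete (f := fun p : X × List X => p.1 :: p.2)).comp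
        ((hΦ a).prodMk (ih (a + 1)))
  exact (measurable_from_prod_countable_right
    (f := fun p : (ℕ × ℕ) × Ω => (List.range' p.1.1 (p.1.2 - p.1.1)).map fun i => Φ i p.2)
    fun p => hword (p.2 - p.1) p.1).comp
    (((measurable_visitTime hΦ m).prodMk (measurable_visitTime hΦ (m + 1))).prodMk measurable_id)

theorem measurable_cycleHistory (hΦ : ∀ n, Measurable (Φ n)) (m : ℕ) :
    Measurable fun ω => cycleHistory xs (fun i => Φ i ω) m := by
  induction m with
  | zero => exact measurable_const
  | succ m ih =>
    exact (Measurable.of_discrete (f := fun p : List X × List (List X) => p.1 :: p.2)).comp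
      ((measurable_cycleWord hΦ m).prodMk ih)

end

section

variable {X Ω : Type*} [Fintype X] [DecidableEq X] [MeasurableSpace X]
  [MeasurableSingletonClass X] [MeasurableSpace Ω] {Q : Matrix X X ℝ} {μ : Measure Ω}
  {Φ : ℕ → Ω → X} {xs : X}

/-- Almost every trajectory visits `xs` infinitely often: the return words exhaust the mass of
every cylinder. -/
theorem IsMarkovChain.ae_visits [IsProbabilityMeasure μ] (hΦ : IsMarkovChain Q μ Φ)
    (hQ : Q ∈ Matrix.rowStochastic ℝ X) (hirr : Q.IsIrreducible) :
    ∀ᵐ ω ∂μ, ∀ n, ∃ i, n < i ∧ Φ i ω = xs := by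
  have hnn := (Matrix.mem_rowStochastic_iff_sum.1 hQ).1
  rw [ae_all_iff]
  intro n
  have hcyl : ∀ y : ℕ → X, ∀ᵐ ω ∂μ, (∀ i ≤ n, Φ i ω = y i) → ∃ i, n < i ∧ Φ i ω = xs := by
    intro y
    set S := {ω | ∀ i ≤ n, Φ i ω = y i}
    set T : List X → Set Ω := fun l => {ω | (∀ i ≤ n, Φ i ω = y i) ∧
      Follows xs (fun i => Φ i ω) (n + 1) l}
    have hTm : ∀ l, MeasurableSet (T l) := fun l =>
      (measurableSet_cylinder hΦ.measurable n y).inter (measurableSet_follows hΦ.measurable _ l)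
    have hTd : Pairwise (Function.onFun Disjoint T) := by
      intro l k hlk
      refine Set.disjoint_left.2 fun ω hl hk => hlk (hl.2.unique hk.2)
    have hμ : μ (⋃ l, T l) = μ S := by
      rw [measure_iUnion hTd hTm]
      have : ∀ l, μ (T l) = ENNReal.ofReal (μ.real S * returnWeight Q xs (y n) l) := fun l => by
        rw [← hΦ.measureReal_follows, ofReal_measureReal]
      simp only [this]
      have hs := (hasSum_returnWeight (xs := xs) hQ hirr (y n)).mul_left (μ.real S)
      rw [← ENNReal.ofReal_tsum_of_nonneg
        (fun l => mul_nonneg measureReal_nonneg (returnWeight_nonneg hnn _ l)) hs.summable,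
        hs.tsum_eq, mul_one, ofReal_measureReal]
    have hdiff : μ (S \ ⋃ l, T l) = 0 := by
      rw [measure_sdiff (s₁ := S) (Set.iUnion_subset fun l ω (hω : ω ∈ T l) => hω.1)
        (MeasurableSet.iUnion hTm).nullMeasurableSet (measure_ne_top _ _), hμ, tsub_self]
    filter_upwards [measure_eq_zero_iff_ae_notMem.1 hdiff] with ω hω hωS
    by_contra hno
    refine hω ⟨hωS, fun hmem => hno ?_⟩
    obtain ⟨l, hl⟩ := Set.mem_iUnion.1 hmem
    obtain ⟨i, hi, hx⟩ := hl.2.exists_eq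
    exact ⟨i, hi, hx⟩
  have hall : ∀ᵐ ω ∂μ, ∀ p : Fin (n + 1) → X,
      (∀ i ≤ n, Φ i ω = if h : i < n + 1 then p ⟨i, h⟩ else xs) → ∃ i, n < i ∧ Φ i ω = xs :=
    ae_all_iff.2 fun p => hcyl fun i => if h : i < n + 1 then p ⟨i, h⟩ else xs
  filter_upwards [hall] with ω hω
  refine hω (fun i => Φ i ω) fun i hi => ?_
  rw [dif_pos (Nat.lt_succ_of_le hi)]

/-- Regeneration: after the initial cycle, the next cycle is independent of the past and has law
`cycleLaw Q xs`. -/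
theorem IsMarkovChain.measure_cycleHistory_cycleWord [IsProbabilityMeasure μ]
    (hΦ : IsMarkovChain Q μ Φ) (hQ : Q ∈ Matrix.rowStochastic ℝ X) (hirr : Q.IsIrreducible)
    (m : ℕ) (h : List (List X)) (w : List X) :
    μ {ω | cycleHistory xs (fun i => Φ i ω) (m + 1) = h ∧
        cycleWord xs (fun i => Φ i ω) (m + 1) = w} =
      μ {ω | cycleHistory xs (fun i => Φ i ω) (m + 1) = h} * cycleLaw Q xs {w} := by
  have hgood := hΦ.ae_visits (xs := xs) hQ hirr
  rw [cycleLaw_singleton]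
  by_cases hw : ∃ l, w = xs :: l
  · obtain ⟨l, rfl⟩ := hw
    by_cases hex : ∃ ω₀, (∀ n, ∃ i, n < i ∧ Φ i ω₀ = xs) ∧
        cycleHistory xs (fun i => Φ i ω₀) (m + 1) = h
    · obtain ⟨ω₀, hω₀, rfl⟩ := hex
      -- On trajectories that keep visiting `xs`, both events are cylinders read off from `ω₀`.
      set n := visitTime xs (fun i => Φ i ω₀) (m + 1)
      have hn' : Φ n ω₀ = xs := (visitTime_succ_mem (φ := fun i => Φ i ω₀) hω₀ m).2
      have h1 : μ {ω | cycleHistory xs (fun i => Φ i ω) (m + 1) =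
          cycleHistory xs (fun i => Φ i ω₀) (m + 1)} = μ {ω | ∀ i ≤ n, Φ i ω = Φ i ω₀} := by
        refine measure_congr (Filter.eventuallyEq_set.2 ?_)
        filter_upwards [hgood] with ω hω
        exact cycleHistory_succ_eq_iff (φ := fun i => Φ i ω₀) (ψ := fun i => Φ i ω) hω₀ hω m
      have h2 : μ {ω | cycleHistory xs (fun i => Φ i ω) (m + 1) =
          cycleHistory xs (fun i => Φ i ω₀) (m + 1) ∧
            cycleWord xs (fun i => Φ i ω) (m + 1) = xs :: l} =
          μ {ω | (∀ i ≤ n, Φ i ω = Φ i ω₀) ∧ Follows xs (fun i => Φ i ω) (n + 1) l} := by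
        refine measure_congr (Filter.eventuallyEq_set.2 ?_)
        filter_upwards [hgood] with ω hω
        rw [cycleHistory_succ_eq_iff (φ := fun i => Φ i ω₀) (ψ := fun i => Φ i ω) hω₀ hω m,
          cycleWord_succ_eq_iff (φ := fun i => Φ i ω) hω m l]
        refine and_congr_right fun hag => ?_
        rw [(cycleHistory_congr (φ := fun i => Φ i ω₀) (ψ := fun i => Φ i ω) hω₀ (m + 1) hag).1]
      have h3 := hΦ.measureReal_follows (xs := xs) n (fun i => Φ i ω₀) l
      rw [h1, h2, ← ofReal_measureReal, h3, hn', ENNReal.ofReal_mul measureReal_nonneg,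
        ofReal_measureReal, cycleWeight, if_pos rfl]
    · have h0 : μ {ω | cycleHistory xs (fun i => Φ i ω) (m + 1) = h} = 0 := by
        rw [measure_eq_zero_iff_ae_notMem]
        filter_upwards [hgood] with ω hω hmem
        exact hex ⟨ω, hω, hmem⟩
      rw [h0, zero_mul]
      exact measure_mono_null (fun ω hω => hω.1) h0
  · have h0 : cycleWeight Q xs w = 0 := by
      rcases w with _ | ⟨x, l⟩
      · rfl
      · rw [cycleWeight, if_neg]
        rintro rfl
        exact hw ⟨l, rfl⟩
    rw [h0, ENNReal.ofReal_zero, mul_zero, measure_eq_zero_iff_ae_notMem]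
    filter_upwards [hgood] with ω hω hmem
    obtain ⟨l, hl⟩ := exists_cycleWord_succ_eq (φ := fun i => Φ i ω) hω m
    exact hw ⟨l, hmem.2.symm.trans hl⟩

theorem IsMarkovChain.map_cycleHistory_cycleWord [IsProbabilityMeasure μ]
    (hΦ : IsMarkovChain Q μ Φ) (hQ : Q ∈ Matrix.rowStochastic ℝ X) (hirr : Q.IsIrreducible)
    (m : ℕ) :
    μ.map (fun ω => (cycleHistory xs (fun i => Φ i ω) (m + 1),
        cycleWord xs (fun i => Φ i ω) (m + 1))) =
      (μ.map fun ω => cycleHistory xs (fun i => Φ i ω) (m + 1)).prod (cycleLaw Q xs) := by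
  have := isProbabilityMeasure_cycleLaw (xs := xs) hQ hirr
  have hH := measurable_cycleHistory (xs := xs) hΦ.measurable (m + 1)
  have hW := measurable_cycleWord (xs := xs) hΦ.measurable (m + 1)
  refine Measure.ext_of_singleton fun p => ?_
  obtain ⟨h, w⟩ := p
  rw [Measure.map_apply (hH.prodMk hW) (measurableSet_singleton _), ← Set.singleton_prod_singleton,
    Measure.prod_prod, Measure.map_apply hH (measurableSet_singleton _)]
  exact hΦ.measure_cycleHistory_cycleWord hQ hirr m h w

end

/-! ### Convergence of the noise -/

/-- A series of martingale differences with square-summable uniform bounds converges almost surely: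
by orthogonality the partial sums form a martingale bounded in `L²`. -/
theorem ae_exists_tendsto_sum_of_condExp_eq_zero {Ω : Type*} {mΩ : MeasurableSpace Ω}
    {μ : Measure Ω} [IsProbabilityMeasure μ] (ℱ : Filtration ℕ mΩ) {ξ : ℕ → Ω → ℝ} {b : ℕ → ℝ}
    (hξm : ∀ k, StronglyMeasurable[ℱ (k + 1)] (ξ k)) (hξb : ∀ k ω, |ξ k ω| ≤ b k)
    (hξ0 : ∀ k, μ[ξ k | ℱ k] =ᵐ[μ] 0) (hb : Summable fun k => b k ^ 2) :
    ∀ᵐ ω ∂μ, ∃ c, Tendsto (fun n => ∑ k ∈ Finset.range n, ξ k ω) atTop (𝓝 c) := by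
  set N : ℕ → Ω → ℝ := fun n ω => ∑ k ∈ Finset.range n, ξ k ω with hN
  have hNs : ∀ n, N (n + 1) = N n + ξ n := fun n => funext fun ω => Finset.sum_range_succ _ _
  have hNm : StronglyAdapted ℱ N := by
    intro n
    refine Finset.stronglyMeasurable_fun_sum _ fun k hk => ?_
    exact (hξm k).mono (ℱ.mono (Finset.mem_range.1 hk))
  have hNb : ∀ n ω, |N n ω| ≤ ∑ k ∈ Finset.range n, b k := fun n ω =>
    (Finset.abs_sum_le_sum_abs _ _).trans (Finset.sum_le_sum fun k _ => hξb k ω)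
  have hbdd : ∀ {f : Ω → ℝ} (c : ℝ), StronglyMeasurable f → (∀ ω, |f ω| ≤ c) → Integrable f μ :=
    fun c hf hc => Integrable.of_bound hf.aestronglyMeasurable c (ae_of_all _ hc)
  have hNm' : ∀ n, StronglyMeasurable (N n) := fun n => (hNm n).mono (ℱ.le n)
  have hξm' : ∀ n, StronglyMeasurable (ξ n) := fun n => (hξm n).mono (ℱ.le _)
  have hNi : ∀ n, Integrable (N n) μ := fun n => hbdd _ (hNm' n) (hNb n)
  have hξi : ∀ n, Integrable (ξ n) μ := fun n => hbdd _ (hξm' n) (hξb n)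
  have hmul : ∀ {f g : Ω → ℝ} {c d : ℝ}, StronglyMeasurable f → StronglyMeasurable g →
      (∀ ω, |f ω| ≤ c) → (∀ ω, |g ω| ≤ d) → Integrable (f * g) μ := by
    intro f g c d hf hg hc hd
    refine hbdd (c * d) (hf.mul hg) fun ω => ?_
    rw [Pi.mul_apply, abs_mul]
    exact mul_le_mul (hc ω) (hd ω) (abs_nonneg _) ((abs_nonneg _).trans (hc ω))
  have horth : ∀ n, ∫ ω, (N n * ξ n) ω ∂μ = 0 := by
    intro n
    have h1 : μ[N n * ξ n | ℱ n] =ᵐ[μ] 0 := by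
      refine (condExp_mul_of_stronglyMeasurable_left (hNm n)
        (hmul (hNm' n) (hξm' n) (hNb n) (hξb n)) (hξi n)).trans ?_
      filter_upwards [hξ0 n] with ω hω
      simp [hω]
    rw [← integral_condExp (ℱ.le n), integral_congr_ae h1]
    simp
  have hsq : ∀ n, ∫ ω, (N n * N n) ω ∂μ ≤ ∑ k ∈ Finset.range n, b k ^ 2 := by
    intro n
    induction n with
    | zero => simp [hN]
    | succ n ih =>
      have hexp : N (n + 1) * N (n + 1) = (N n * N n + (N n * ξ n + N n * ξ n)) + ξ n * ξ n := by
        rw [hNs]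
        ring
      have i1 := hmul (hNm' n) (hNm' n) (hNb n) (hNb n)
      have i2 := hmul (hNm' n) (hξm' n) (hNb n) (hξb n)
      have i3 := hmul (hξm' n) (hξm' n) (hξb n) (hξb n)
      have h3 : ∫ ω, (ξ n * ξ n) ω ∂μ ≤ b n ^ 2 := by
        have : ∫ ω, (ξ n * ξ n) ω ∂μ ≤ ∫ _, b n ^ 2 ∂μ := by
          refine integral_mono i3 (integrable_const _) fun ω => ?_
          simp only [Pi.mul_apply]
          rw [← abs_mul_abs_self, ← sq]
          exact pow_le_pow_left₀ (abs_nonneg _) (hξb n ω) 2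
        simpa using this
      rw [hexp, integral_add' (i1.add (i2.add i2)) i3, integral_add' i1 (i2.add i2),
        integral_add' i2 i2, horth, Finset.sum_range_succ]
      linarith
  have hmart : Martingale N ℱ μ := by
    refine martingale_nat hNm hNi fun n => ?_
    rw [hNs]
    filter_upwards [condExp_add (hNi n) (hξi n) (ℱ n), hξ0 n] with ω h1 h2
    rw [h1, Pi.add_apply, h2, condExp_of_stronglyMeasurable (ℱ.le n) (hNm n) (hNi n)]
    simp
  refine hmart.submartingale.exists_ae_tendsto_of_bdd
    (R := Real.toNNReal (1 + ∑' k, b k ^ 2)) fun n => ?_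
  rw [eLpNorm_one_eq_lintegral_enorm, ← ofReal_integral_norm_eq_lintegral_enorm (hNi n)]
  refine ENNReal.ofReal_le_ofReal ?_
  have i1 := hmul (hNm' n) (hNm' n) (hNb n) (hNb n)
  calc ∫ ω, ‖N n ω‖ ∂μ ≤ ∫ ω, 1 + (N n * N n) ω ∂μ := by
        refine integral_mono (hNi n).norm ((integrable_const 1).add i1) fun ω => ?_
        simp only [Pi.mul_apply, Real.norm_eq_abs]
        nlinarith [abs_mul_abs_self (N n ω), sq_nonneg (|N n ω| - 1), abs_nonneg (N n ω)]
    _ = 1 + ∫ ω, (N n * N n) ω ∂μ := by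
        rw [integral_add (integrable_const 1) i1]
        simp
    _ ≤ 1 + ∑' k, b k ^ 2 := by
        have := hb.sum_le_tsum (Finset.range n) fun k _ => sq_nonneg (b k)
        linarith [hsq n]

/-- If the innovation `W k` is independent of the history `H k` and has law `ν`, then the centred
functionals `g k (H k) (W k)` are martingale differences, and their series converges almost surely
when they have square-summable bounds. -/
theorem ae_exists_tendsto_sum_of_map_eq_prod {Ω S T : Type*} [MeasurableSpace Ω]
    [MeasurableSpace S] [DiscreteMeasurableSpace S] [Countable S] [MeasurableSpace T]
    [DiscreteMeasurableSpace T] [Countable T]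
    {μ : Measure Ω} [IsProbabilityMeasure μ] {ν : Measure T} [IsProbabilityMeasure ν]
    {H : ℕ → Ω → S} {W : ℕ → Ω → T} (hH : ∀ k, Measurable (H k)) (hW : ∀ k, Measurable (W k))
    {past : S → S} {last : S → T} (hpast : ∀ k ω, past (H (k + 1) ω) = H k ω)
    (hlast : ∀ k ω, last (H (k + 1) ω) = W k ω)
    (hlaw : ∀ k, μ.map (fun ω => (H k ω, W k ω)) = (μ.map (H k)).prod ν)
    {g : ℕ → S → T → ℝ} {b : ℕ → ℝ} (hgb : ∀ k h w, |g k h w| ≤ b k)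
    (hg0 : ∀ k h, ∫ w, g k h w ∂ν = 0) (hb : Summable fun k => b k ^ 2) :
    ∀ᵐ ω ∂μ, ∃ c, Tendsto (fun n => ∑ k ∈ Finset.range n, g k (H k ω) (W k ω)) atTop (𝓝 c) := by
  have hcomap : ∀ k, MeasurableSpace.comap (H k) inferInstance ≤
      MeasurableSpace.comap (H (k + 1)) inferInstance := by
    rintro k _ ⟨A, -, rfl⟩
    refine ⟨past ⁻¹' A, MeasurableSet.of_discrete, ?_⟩
    ext ω
    simp [hpast]
  let ℱ : Filtration ℕ ‹MeasurableSpace Ω› :=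
    { seq := fun k => MeasurableSpace.comap (H k) inferInstance
      mono' := monotone_nat_of_le_succ hcomap
      le' := fun k => (hH k).comap_le }
  have hHW : ∀ k, Measurable fun ω => (H k ω, W k ω) := fun k => (hH k).prodMk (hW k)
  have hgm : ∀ k, Measurable fun p : S × T => g k p.1 p.2 := fun k => Measurable.of_discrete
  have hξm : ∀ k, Measurable fun ω => g k (H k ω) (W k ω) := fun k => (hgm k).comp (hHW k)
  have hξi : ∀ k, Integrable (fun ω => g k (H k ω) (W k ω)) μ := fun k =>
    Integrable.of_bound (hξm k).aestronglyMeasurable (b k) (ae_of_all _ fun ω => hgb k _ _)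
  refine ae_exists_tendsto_sum_of_condExp_eq_zero ℱ (ξ := fun k ω => g k (H k ω) (W k ω)) ?_
    (fun k ω => hgb k _ _) (fun k => ?_) hb
  · intro k
    have : (fun ω => g k (H k ω) (W k ω)) =
        (fun h => g k (past h) (last h)) ∘ H (k + 1) := by
      ext ω
      simp [hpast, hlast]
    rw [this]
    exact ((Measurable.of_discrete (f := fun h => g k (past h) (last h))).comp
      (comap_measurable (H (k + 1)))).stronglyMeasurable
  · refine (ae_eq_condExp_of_forall_setIntegral_eq (ℱ.le k) (hξi k)
      (fun s _ _ => (integrable_zero _ _ _).integrableOn) ?_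
      stronglyMeasurable_zero.aestronglyMeasurable).symm
    rintro _ ⟨A, -, rfl⟩ -
    have hprob : IsProbabilityMeasure (μ.map (H k)) := Measure.isProbabilityMeasure_map
      (hH k).aemeasurable
    have hpre : H k ⁻¹' A = (fun ω => (H k ω, W k ω)) ⁻¹' (A ×ˢ Set.univ) := by
      ext ω
      simp
    rw [hpre, ← setIntegral_map (f := fun p : S × T => g k p.1 p.2) MeasurableSet.of_discrete
      (hgm k).aestronglyMeasurable (hHW k).aemeasurable, hlaw, setIntegral_prod]
    · simp [hg0]
    · exact (Integrable.of_bound (hgm k).aestronglyMeasurable (b k)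
        (ae_of_all _ fun p => hgb k _ _)).integrableOn

/-! ### Robbins–Monro iterations -/

/-- Upper half of the convergence of a Robbins–Monro iteration. After subtraction of the noise the
iteration decreases at rate at least `δ γ` above the level `Λ + 2 ε`; it gets below this level
because `∑ γ = ∞`, and then stays near it because the drift steps tend to `0`. -/
theorem eventually_le_of_robbinsMonro {x d ξ γ : ℕ → ℝ} {Λ : ℝ}
    (hx : ∀ m, x (m + 1) = x m + d m + ξ m) (hγ : ∀ m, 0 < γ m)
    (hγdiv : Tendsto (fun n => ∑ m ∈ Finset.range n, γ m) atTop atTop)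
    {s : ℝ} (hξ : Tendsto (fun n => ∑ m ∈ Finset.range n, ξ m) atTop (𝓝 s))
    (hd : Tendsto d atTop (𝓝 0))
    (hdrift : ∀ ε > 0, ∃ δ > 0, ∀ᶠ m in atTop, Λ + ε ≤ x m → d m ≤ -(δ * γ m))
    {ε : ℝ} (hε : 0 < ε) : ∀ᶠ m in atTop, x m ≤ Λ + 4 * ε := by
  set S : ℕ → ℝ := fun n => ∑ m ∈ Finset.range n, ξ m with hS
  set z : ℕ → ℝ := fun n => x n - S n with hz
  have hzs : ∀ m, z (m + 1) = z m + d m := by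
    intro m
    simp only [hz, hS, hx, Finset.sum_range_succ]
    ring
  obtain ⟨δ, hδ, hdr⟩ := hdrift ε hε
  have hSε : ∀ᶠ m in atTop, |S m - s| < ε := by
    simpa [Real.dist_eq] using (Metric.tendsto_nhds.1 hξ) ε hε
  have hdε : ∀ᶠ m in atTop, d m < ε := hd.eventually_lt_const hε
  obtain ⟨N, hN⟩ := eventually_atTop.1 (hdr.and (hSε.and hdε))
  set c := Λ + 2 * ε - s with hc
  have habove : ∀ m ≥ N, c ≤ z m → d m ≤ -(δ * γ m) := by
    intro m hm hcm
    refine (hN m hm).1 ?_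
    have := (abs_lt.1 (hN m hm).2.1).1
    simp only [hz] at hcm
    linarith
  obtain ⟨m₀, hm₀, hlt⟩ : ∃ m ≥ N, z m < c := by
    by_contra! hno
    have hdec : ∀ k, z (N + k) ≤ z N + δ * ∑ m ∈ Finset.range N, γ m -
        δ * ∑ m ∈ Finset.range (N + k), γ m := by
      intro k
      induction k with
      | zero => simp
      | succ k ih =>
        have := habove (N + k) (by omega) (hno _ (by omega))
        rw [← add_assoc, hzs, Finset.sum_range_succ, mul_add]
        linarith
    obtain ⟨n, hn, hnN⟩ := ((hγdiv.eventually_gt_atTop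
      ((z N + δ * ∑ m ∈ Finset.range N, γ m - c) / δ)).and (eventually_ge_atTop N)).exists
    obtain ⟨k, rfl⟩ := Nat.exists_eq_add_of_le hnN
    rw [div_lt_iff₀ hδ] at hn
    have := hno (N + k) (by omega)
    linarith [hdec k]
  refine eventually_atTop.2 ⟨m₀, fun m hm => ?_⟩
  have hstay : z m ≤ c + ε := by
    induction m, hm using Nat.le_induction with
    | base => linarith
    | succ m hm ih =>
      rw [hzs]
      rcases lt_or_ge (z m) c with h | h
      · linarith [(hN m (hm₀.trans hm)).2.2]
      · have := habove m (hm₀.trans hm) h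
        have := mul_pos hδ (hγ m)
        linarith
  have := (abs_lt.1 (hN m (hm₀.trans hm)).2.1).2
  simp only [hz] at hstay
  linarith

/-- A Robbins–Monro iteration with summable noise, vanishing drift steps and a drift that points
towards `Λ` converges to `Λ`. -/
theorem tendsto_of_robbinsMonro {x d ξ γ : ℕ → ℝ} {Λ : ℝ}
    (hx : ∀ m, x (m + 1) = x m + d m + ξ m) (hγ : ∀ m, 0 < γ m)
    (hγdiv : Tendsto (fun n => ∑ m ∈ Finset.range n, γ m) atTop atTop)
    {s : ℝ} (hξ : Tendsto (fun n => ∑ m ∈ Finset.range n, ξ m) atTop (𝓝 s))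
    (hd : Tendsto d atTop (𝓝 0))
    (hup : ∀ ε > 0, ∃ δ > 0, ∀ᶠ m in atTop, Λ + ε ≤ x m → d m ≤ -(δ * γ m))
    (hlow : ∀ ε > 0, ∃ δ > 0, ∀ᶠ m in atTop, x m ≤ Λ - ε → δ * γ m ≤ d m) :
    Tendsto x atTop (𝓝 Λ) := by
  rw [Metric.tendsto_nhds]
  intro ε hε
  have h1 := eventually_le_of_robbinsMonro hx hγ hγdiv hξ hd hup (ε := ε / 8) (by positivity)
  have h2 := eventually_le_of_robbinsMonro (x := fun m => -x m) (d := fun m => -d m)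
    (ξ := fun m => -ξ m) (Λ := -Λ) (s := -s) (fun m => by rw [hx]; ring) hγ hγdiv
    (by simpa using hξ.neg) (by simpa using hd.neg) (fun ε hε => by
      obtain ⟨δ, hδ, h⟩ := hlow ε hε
      refine ⟨δ, hδ, h.mono fun m hm hxm => ?_⟩
      linarith [hm (by linarith)]) (ε := ε / 8) (by positivity)
  filter_upwards [h1, h2] with m h1 h2
  rw [Real.dist_eq, abs_lt]
  constructor <;> linarith

/-! ### The policy-evaluation iteration -/

/-- The truncated exponential of the cost of the cycle `w`, centred at `a`. -/
noncomputable def truncatedPayoff {X : Type*} (C : X → ℝ) (α M a : ℝ) (w : List X) : ℝ :=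
  min (Real.exp (w.map fun y => α * C y - a).sum) M

/-- The policy-evaluation iteration as a function of the cycles seen so far. -/
noncomputable def cycleEstimate {X : Type*} (C : X → ℝ) (α : ℝ) (γ M : ℕ → ℝ) (L₀ : ℝ) :
    List (List X) → ℝ
  | [] => L₀
  | w :: h => cycleEstimate C α γ M L₀ h + γ h.length *
      (truncatedPayoff C α (M h.length) (cycleEstimate C α γ M L₀ h) w - 1)

theorem costEstimate_eq_cycleEstimate {X : Type*} (C : X → ℝ) (α : ℝ) (xs : X) (γ M : ℕ → ℝ)
    (L₀ : ℝ) (φ : ℕ → X) (m : ℕ) :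
    costEstimate C α xs γ M L₀ φ m = cycleEstimate C α γ M L₀ (cycleHistory xs φ m) := by
  induction m with
  | zero => rfl
  | succ m ih =>
    have hsum : ∀ (f : X → ℝ) (a b : ℕ),
        ∑ i ∈ Finset.Ico a b, f (φ i) = (((List.range' a (b - a)).map φ).map f).sum := by
      intro f a b
      rw [List.map_map]
      rfl
    rw [costEstimate, hsum (fun y => α * C y - costEstimate C α xs γ M L₀ φ m), ih, cycleHistory,
      cycleEstimate, length_cycleHistory, truncatedPayoff, cycleWord]

theorem sum_map_sub_eq {X : Type*} (C : X → ℝ) (α a b : ℝ) (w : List X) :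
    (w.map fun y => α * C y - a).sum = (w.map fun y => α * C y - b).sum + w.length * (b - a) := by
  induction w with
  | nil => simp
  | cons x w ih =>
    simp only [List.map_cons, List.sum_cons, ih, List.length_cons, Nat.cast_add, Nat.cast_one]
    ring

theorem exp_sum_map_sub_le {X : Type*} (C : X → ℝ) {α a b ε : ℝ} {w : List X} (hw : 1 ≤ w.length)
    (hε : 0 ≤ ε) (hab : b + ε ≤ a) :
    Real.exp ε * Real.exp (w.map fun y => α * C y - a).sum ≤
      Real.exp (w.map fun y => α * C y - b).sum := by
  rw [← Real.exp_add, Real.exp_le_exp, sum_map_sub_eq C α b a]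
  have : (1 : ℝ) ≤ w.length := by exact_mod_cast hw
  nlinarith

theorem truncatedPayoff_mem {X : Type*} (C : X → ℝ) (α : ℝ) {M : ℝ} (hM : 0 < M) (a : ℝ)
    (w : List X) : truncatedPayoff C α M a w ∈ Set.Icc 0 M :=
  ⟨le_min (Real.exp_pos _).le hM.le, min_le_right _ _⟩

theorem integrable_truncatedPayoff {X : Type*} (C : X → ℝ) (α : ℝ) {M : ℝ} (hM : 0 < M)
    (a : ℝ) (ν : Measure (List X)) [IsFiniteMeasure ν] :
    Integrable (truncatedPayoff C α M a) ν :=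
  Integrable.of_bound Measurable.of_discrete.aestronglyMeasurable M (ae_of_all _ fun w => by
    have := truncatedPayoff_mem C α hM a w
    rw [Real.norm_eq_abs, abs_of_nonneg this.1]
    exact this.2)

theorem integral_truncatedPayoff_mem {X : Type*} (C : X → ℝ) (α : ℝ) {M : ℝ} (hM : 0 < M)
    (a : ℝ) (ν : Measure (List X)) [IsProbabilityMeasure ν] :
    ∫ w, truncatedPayoff C α M a w ∂ν ∈ Set.Icc 0 M := by
  refine ⟨integral_nonneg fun w => (truncatedPayoff_mem C α hM a w).1, ?_⟩
  have := integral_mono (integrable_truncatedPayoff C α hM a ν) (integrable_const M)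
    fun w => (truncatedPayoff_mem C α hM a w).2
  simpa using this

section

variable {X : Type*} {C : X → ℝ} {α Λ : ℝ} {ν : Measure (List X)} [IsProbabilityMeasure ν]

/-- Above the level `Λ` the mean field is below `exp (-ε)`, as every cycle has length at least
`1`. -/
theorem integral_truncatedPayoff_le (hν : ∀ᵐ w ∂ν, 1 ≤ w.length)
    (hi : Integrable (fun w : List X => Real.exp (w.map fun y => α * C y - Λ).sum) ν)
    (h1 : ∫ w : List X, Real.exp (w.map fun y => α * C y - Λ).sum ∂ν = 1) {M a ε : ℝ}
    (hM : 0 < M) (hε : 0 ≤ ε) (ha : Λ + ε ≤ a) :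
    ∫ w, truncatedPayoff C α M a w ∂ν ≤ Real.exp (-ε) := by
  have : ∫ w, truncatedPayoff C α M a w ∂ν ≤
      ∫ w : List X, Real.exp (-ε) * Real.exp (w.map fun y => α * C y - Λ).sum ∂ν := by
    refine integral_mono_ae (integrable_truncatedPayoff C α hM a ν) (hi.const_mul _) ?_
    filter_upwards [hν] with w hw
    refine (min_le_left _ _).trans ?_
    have := exp_sum_map_sub_le C (α := α) hw hε ha
    rw [Real.exp_neg, ← div_eq_inv_mul, le_div_iff₀ (Real.exp_pos ε), mul_comm]
    exact this
  rwa [integral_const_mul, h1, mul_one] at this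

/-- Below the level `Λ` the mean field exceeds `1` once the truncation level is large, uniformly
in the argument: it is bounded below by the truncated mean of `exp ε` times the centred payoff,
which tends to `exp ε`. -/
theorem eventually_le_integral_truncatedPayoff (hν : ∀ᵐ w ∂ν, 1 ≤ w.length)
    (hi : Integrable (fun w : List X => Real.exp (w.map fun y => α * C y - Λ).sum) ν)
    (h1 : ∫ w : List X, Real.exp (w.map fun y => α * C y - Λ).sum ∂ν = 1) {M : ℕ → ℝ}
    (hM : ∀ m, 0 < M m) (hMtop : Tendsto M atTop atTop) {ε : ℝ} (hε : 0 < ε) :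
    ∃ δ > 0, ∀ᶠ m in atTop, ∀ a ≤ Λ - ε, 1 + δ ≤ ∫ w, truncatedPayoff C α (M m) a w ∂ν := by
  set Z : List X → ℝ := fun w => Real.exp ε * Real.exp (w.map fun y => α * C y - Λ).sum with hZ
  have hZi : Integrable Z ν := hi.const_mul _
  have hlim : Tendsto (fun m => ∫ w, min (Z w) (M m) ∂ν) atTop (𝓝 (Real.exp ε)) := by
    have hZ1 : ∫ w, Z w ∂ν = Real.exp ε := by rw [integral_const_mul, h1, mul_one]
    rw [← hZ1]
    refine tendsto_integral_of_dominated_convergence Z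
      (fun m => Measurable.of_discrete.aestronglyMeasurable) hZi
      (fun m => ae_of_all _ fun w => ?_) (ae_of_all _ fun w => ?_)
    · have hZw : 0 ≤ Z w := by positivity
      rw [Real.norm_eq_abs, abs_of_nonneg (le_min hZw (hM m).le)]
      exact min_le_left _ _
    · refine tendsto_const_nhds.congr' ?_
      filter_upwards [hMtop.eventually_ge_atTop (Z w)] with m hm
      rw [min_eq_left hm]
  have hexp : 1 < Real.exp ε := Real.one_lt_exp_iff.2 hε
  refine ⟨(Real.exp ε - 1) / 2, by linarith, ?_⟩
  filter_upwards [hlim.eventually_const_le (u := 1 + (Real.exp ε - 1) / 2) (by linarith)]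
    with m hm a ha
  refine hm.trans (integral_mono_ae ?_ (integrable_truncatedPayoff C α (hM m) a ν) ?_)
  · exact Integrable.of_bound Measurable.of_discrete.aestronglyMeasurable (M m)
      (ae_of_all _ fun w => by
        rw [Real.norm_eq_abs, abs_of_nonneg (le_min (by positivity) (hM m).le)]
        exact min_le_right _ _)
  · filter_upwards [hν] with w hw
    exact min_le_min_right _ (exp_sum_map_sub_le C hw hε.le (by linarith))

end

/-! ### Convergence to the risk-sensitive cost -/

theorem mainTheorem2 {X Ω : Type*} [Fintype X] [DecidableEq X]
    [MeasurableSpace X] [MeasurableSingletonClass X] [MeasurableSpace Ω]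
    {l : ℕ} (P : EuclideanSpace ℝ (Fin l) → Matrix X X ℝ)
    (C : EuclideanSpace ℝ (Fin l) → X → ℝ)
    (hP : ErgodicFamily P)
    (hPsmooth : ∀ x y : X, BoundedTwiceDifferentiable (fun θ => P θ x y))
    (hCsmooth : ∀ x : X, BoundedTwiceDifferentiable (fun θ => C θ x))
    (α : ℝ) (hα : 0 < α) (xs : X) (θ : EuclideanSpace ℝ (Fin l))
    (γ : ℕ → ℝ) (hγpos : ∀ m, 0 < γ m)
    (hγdiv : Tendsto (fun n : ℕ => ∑ m ∈ Finset.range n, γ m) atTop atTop)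
    (β : ℝ) (hβ : β ∈ Set.Ioo (0 : ℝ) (1 / 2))
    (hγsum : Summable (fun m : ℕ => γ m ^ (2 * (1 - β))))
    (μ : Measure Ω) [IsProbabilityMeasure μ] (Φ : ℕ → Ω → X)
    (hΦ : IsMarkovChain (P θ) μ Φ) (L₀ : ℝ) :
    ∃ Λ : ℝ, IsRiskSensitiveCost (P θ) (C θ) α Λ ∧
      ∀ᵐ ω ∂μ, Tendsto
        (costEstimate (C θ) α xs γ (fun m => γ m ^ (-β)) L₀ (fun i => Φ i ω))
        atTop (𝓝 Λ) := by
  obtain ⟨hβ0, hβ1⟩ := hβ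
  have : Nonempty X := ⟨xs⟩
  have hQ := hP.stochastic θ
  have hirr := hP.irreducible (P θ) (subset_closure (Set.mem_range_self θ))
  obtain ⟨hnn, hrow⟩ := Matrix.mem_rowStochastic_iff_sum.1 hQ
  have hAirr : (tiltedMatrix (P θ) (C θ) α).IsIrreducible :=
    hirr.of_pos_iff (fun x y => mul_nonneg (Real.exp_pos _).le (hnn x y)) fun x y =>
      (mul_pos_iff_of_pos_left (Real.exp_pos _)).symm
  obtain ⟨ρ, v, hv, heig⟩ := hAirr.exists_pos_eigenvector
  have hρ : 0 < ρ := by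
    have h := congrFun heig xs
    rw [Pi.smul_apply, smul_eq_mul] at h
    refine (mul_pos_iff_of_pos_right (hv xs)).1 (h ▸ ?_)
    obtain ⟨y, hy⟩ : ∃ y, 0 < P θ xs y := by
      by_contra! hno
      have := Finset.sum_nonpos fun y (_ : y ∈ Finset.univ) => hno y
      rw [hrow] at this
      linarith
    exact Finset.sum_pos' (fun z _ => mul_nonneg (hAirr.nonneg xs z) (hv z).le)
      ⟨y, Finset.mem_univ y, mul_pos (mul_pos (Real.exp_pos _) hy) (hv y)⟩
  refine ⟨Real.log ρ, isRiskSensitiveCost_log hnn hρ hv heig, ?_⟩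
  set Λ := Real.log ρ
  rw [← Real.exp_log hρ] at heig
  set ν := cycleLaw (P θ) xs
  have hνprob : IsProbabilityMeasure ν := isProbabilityMeasure_cycleLaw hQ hirr
  have hνlen : ∀ᵐ w ∂ν, 1 ≤ w.length := ae_cycleLaw_one_le_length
  obtain ⟨hZi, hZ1⟩ := integral_cycleLaw_exp (xs := xs) hnn hirr hv heig
  set M : ℕ → ℝ := fun m => γ m ^ (-β) with hM
  have hMpos : ∀ m, 0 < M m := fun m => Real.rpow_pos_of_pos (hγpos m) _
  have hγM : ∀ m, γ m * M m = γ m ^ (1 - β) := fun m => by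
    rw [hM, sub_eq_add_neg, Real.rpow_add (hγpos m), Real.rpow_one]
  -- The step sizes and the largest possible steps tend to `0`, the truncation levels to `∞`.
  have hγpow : ∀ p : ℝ, 0 < p → Tendsto (fun m => γ m ^ p) atTop (𝓝 0) := by
    intro p hp
    have h2 : 0 < 2 * (1 - β) := by linarith
    have h := hγsum.tendsto_atTop_zero.rpow_const (p := p / (2 * (1 - β)))
      (Or.inr (div_pos hp h2).le)
    rw [Real.zero_rpow (div_pos hp h2).ne'] at h
    refine h.congr fun m => ?_
    rw [← Real.rpow_mul (hγpos m).le, mul_div_cancel₀ _ h2.ne']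
  have hγ0 : Tendsto γ atTop (𝓝 0) := by simpa using hγpow 1 one_pos
  have hMtop : Tendsto M atTop atTop := by
    have h := (hγpow β hβ0)
    have h' : Tendsto (fun m => γ m ^ β) atTop (𝓝[>] 0) :=
      tendsto_nhdsWithin_iff.2 ⟨h, Eventually.of_forall fun m => Real.rpow_pos_of_pos (hγpos m) _⟩
    refine h'.inv_tendsto_nhdsGT_zero.congr fun m => ?_
    exact (Real.rpow_neg (hγpos m).le β).symm
  set est := cycleEstimate (C θ) α γ M L₀ with hest
  set f : ℕ → ℝ → ℝ := fun m a => ∫ w, truncatedPayoff (C θ) α (M m) a w ∂ν with hf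
  have hfmem : ∀ m a, f m a ∈ Set.Icc 0 (M m) := fun m a =>
    integral_truncatedPayoff_mem _ _ (hMpos m) a ν
  -- The initial cycle may start anywhere, so the noise is centred from the first visit on only.
  have hnoise : ∀ᵐ ω ∂μ, ∃ c, Tendsto (fun n => ∑ k ∈ Finset.range n, γ (k + 1) *
      (truncatedPayoff (C θ) α (M (k + 1)) (est (cycleHistory xs (fun i => Φ i ω) (k + 1)))
          (cycleWord xs (fun i => Φ i ω) (k + 1)) -
        f (k + 1) (est (cycleHistory xs (fun i => Φ i ω) (k + 1))))) atTop (𝓝 c) := by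
    refine ae_exists_tendsto_sum_of_map_eq_prod (ν := ν)
      (H := fun k ω => cycleHistory xs (fun i => Φ i ω) (k + 1))
      (W := fun k ω => cycleWord xs (fun i => Φ i ω) (k + 1))
      (past := List.tail) (last := fun h => h.headD [])
      (g := fun k h w => γ (k + 1) * (truncatedPayoff (C θ) α (M (k + 1)) (est h) w -
        f (k + 1) (est h))) (b := fun k => γ (k + 1) ^ (1 - β))
      (fun k => measurable_cycleHistory hΦ.measurable _)
      (fun k => measurable_cycleWord hΦ.measurable _) (fun k ω => rfl) (fun k ω => rfl)
      (fun k => hΦ.map_cycleHistory_cycleWord hQ hirr k) ?_ ?_ ?_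
    · intro k h w
      obtain ⟨h1, h2⟩ := hfmem (k + 1) (est h)
      obtain ⟨h3, h4⟩ := truncatedPayoff_mem (C θ) α (hMpos (k + 1)) (est h) w
      rw [← hγM, abs_mul, abs_of_pos (hγpos _)]
      refine mul_le_mul_of_nonneg_left ?_ (hγpos _).le
      rw [abs_le]
      constructor <;> linarith
    · intro k h
      rw [integral_const_mul, integral_sub (integrable_truncatedPayoff _ _ (hMpos _) _ ν)
        (integrable_const _)]
      simp [hf]
    · refine ((summable_nat_add_iff 1).2 hγsum).congr fun k => ?_
      rw [← Real.rpow_natCast, ← Real.rpow_mul (hγpos _).le, Nat.cast_ofNat, mul_comm]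
  filter_upwards [hnoise] with ω hω
  obtain ⟨s, hs⟩ := hω
  have hcost : costEstimate (C θ) α xs γ M L₀ (fun i => Φ i ω) =
      fun m => est (cycleHistory xs (fun i => Φ i ω) m) :=
    funext fun m => costEstimate_eq_cycleEstimate _ _ _ _ _ _ _ m
  rw [hcost, ← tendsto_add_atTop_iff_nat 1]
  set x : ℕ → ℝ := fun k => est (cycleHistory xs (fun i => Φ i ω) (k + 1)) with hx
  refine tendsto_of_robbinsMonro (x := x) (d := fun k => γ (k + 1) * (f (k + 1) (x k) - 1))
    (γ := fun k => γ (k + 1)) (fun k => ?_) (fun k => hγpos _) ?_ hs ?_ ?_ ?_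
  · simp only [hx, hest]
    rw [cycleHistory, cycleEstimate, length_cycleHistory]
    ring
  · have h := (tendsto_add_atTop_iff_nat 1).2 hγdiv
    simp only [Finset.sum_range_succ'] at h
    simpa using tendsto_atTop_add_const_right atTop (-γ 0) h
  · have h1 := (tendsto_add_atTop_iff_nat 1).2 hγ0.neg
    have h2 := (tendsto_add_atTop_iff_nat 1).2 (hγpow (1 - β) (by linarith))
    rw [neg_zero] at h1
    refine tendsto_of_tendsto_of_tendsto_of_le_of_le h1 h2 (fun k => ?_) (fun k => ?_)
    · have := mul_nonneg (hγpos (k + 1)).le (hfmem (k + 1) (x k)).1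
      simp only
      linarith
    · have := mul_le_mul_of_nonneg_left (hfmem (k + 1) (x k)).2 (hγpos (k + 1)).le
      rw [hγM] at this
      simp only
      linarith [hγpos (k + 1)]
  · intro ε hε
    refine ⟨1 - Real.exp (-ε), by simpa using hε, Eventually.of_forall fun k hk => ?_⟩
    have := mul_le_mul_of_nonneg_left
      (integral_truncatedPayoff_le hνlen hZi hZ1 (hMpos (k + 1)) hε.le hk) (hγpos (k + 1)).le
    simp only [hf]
    linarith
  · intro ε hε
    obtain ⟨δ, hδ, hev⟩ :=
      eventually_le_integral_truncatedPayoff hνlen hZi hZ1 hMpos hMtop hε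
    refine ⟨δ, hδ, ((tendsto_add_atTop_nat 1).eventually hev).mono fun k hk hxk => ?_⟩
    have := mul_le_mul_of_nonneg_left (hk (x k) hxk) (hγpos (k + 1)).le
    simp only [hf]
    linarith
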